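/- Notation. For $F:\mathbb R^d\to\mathbb R\cup\{+\infty\}$ ($d\ge 1$), $\operatorname{dom}F=\{F<+\infty\}$ and $F^*(\eta)=\sup_\theta\{\langle\eta,\theta\rangle-F(\theta)\}$; for a matrix $A$, $\|v\|_A^2=\langle v,Av\rangle$; $\preccurlyeq$ is the Loewner order, and $u\otimes u=uu^\top$. Regularizer and geometry. Let $g:\mathbb R^d\to\mathbb R\cup\{+\infty\}$ be proper, lower semicontinuous and convex, with $g\ge 0$. Let $h:\mathbb R^d\to\mathbb R\cup\{+\infty\}$ be a Legendre function: proper, lower semicontinuous, strictly convex, differentiable on the interior of $\operatorname{dom}h$, with $\|\nabla h(u_k)\|\to\infty$ whenever points $u_k$ of the interior of $\operatorname{dom}h$ converge to a boundary point of $\operatorname{dom}h$. Assume that the interior of $\operatorname{dom} h$ meets $\operatorname{dom}g$, and put $\mathcal X=\overline{\operatorname{dom}h}\cap\overline{\operatorname{dom}g}$. Write $D_h(\alpha,\beta)=h(\alpha)-h(\beta)-\langle\nabla h(\beta),\alpha-\beta\rangle\in[0,+\infty]$ for $\beta$ in the interior of $\operatorname{dom}h$. Data. Let $(x_n,y_n)_{n\ge1}$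 be i.i.d. in $\mathbb R^d\times\mathbb R$ with $\mathbb E\|x_n\|_2^2<\infty$ and $\mathbb Ey_n^2<\infty$. Let $f(\theta)=\frac12\mathbb E(\langle x_n,\theta\rangle-y_n)^2$, assume that $\Sigma=\mathbb E[x_n\otimes x_n]$ is invertible, and let $\theta_\Sigma$ be the global minimizer of $f$ over $\mathbb R^d$. Let $\theta_*$ be a minimizer of $f+g$ over $\mathcal X$. Assume that there are $\sigma,\kappa,L>0$ such that (i) $\xi_n=(y_n-\langle\theta_\Sigma,x_n\rangle)x_n$ is square-integrable and $\mathbb E[\xi_n\otimes\xi_n]\preccurlyeq\sigma^2\Sigma$; (ii) $\mathbb E\langle z,x_n\rangle^4\le\kappa\langle z,\Sigma z\rangle^2$ (in particular finite) for all $z\in\mathbb R^d$; (iii) $Lh-\frac12\|\cdot\|_\Sigma^2$ is convex. Algorithm. Let $0<\gamma\le\frac1{4\kappa Ld}$, let $\theta_0$ be a (deterministic) point of the interior of $\operatorname{dom}h$, $\eta_0=\nabla h(\theta_0)$, and for $n\ge1$, with $h_n=h+n\gamma g$, $$\eta_n=\eta_{n-1}-\gamma(\langle x_n,\theta_{n-1}\rangle-y_n)x_n,\qquad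 \theta_n=\nabla h_n^*(\eta_n),\qquad \bar\theta_n=\frac1n\sum_{k=0}^{n-1}\theta_k .$$ Conclusion. For every $n\ge1$, $$\frac12\mathbb E\|\bar\theta_n-\theta_*\|_\Sigma^2\le\frac{2D_h(\theta_*,\theta_0)}{\gamma n}+\frac{32d}{n}\bigl(\sigma^2+\kappa\|\theta_*-\theta_\Sigma\|_\Sigma^2\bigr)+\frac{16\kappa d}{n^2}\Bigl(\frac{5D_h(\theta_*,\theta_0)}{\gamma}+g(\theta_0)\Bigr),$$ where the right-hand side is $+\infty$ if $h(\theta_*)=+\infty$ or $g(\theta_0)=+\infty$. -/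

import Mathlib

open MeasureTheory ProbabilityTheory Filter Topology
open scoped ENNReal

namespace DualAveraging

/-- The Euclidean space of dimension `d`. -/
abbrev Vec (d : ℕ) := EuclideanSpace ℝ (Fin d)

section ConvexAnalysis

variable {d : ℕ}

/-- The effective domain of an extended-real-valued function. -/
def dom (F : Vec d → EReal) : Set (Vec d) := {θ | F θ ≠ ⊤}

/-- A proper function: it takes values in `ℝ ∪ {+∞}` and is not identically `+∞`. -/
def IsProper (F : Vec d → EReal) : Prop :=
  (∀ θ, F θ ≠ ⊥) ∧ (dom F).Nonempty

/-- Convexity of a function with values in `ℝ ∪ {+∞}`. -/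
def IsConvex (F : Vec d → EReal) : Prop :=
  ∀ θ₁ θ₂ : Vec d, ∀ a b : ℝ, 0 < a → 0 < b → a + b = 1 →
    F (a • θ₁ + b • θ₂) ≤ (a : EReal) * F θ₁ + (b : EReal) * F θ₂

/-- Strict convexity (on its effective domain) of a function with values in `ℝ ∪ {+∞}`. -/
def IsStrictlyConvex (F : Vec d → EReal) : Prop :=
  ∀ θ₁ ∈ dom F, ∀ θ₂ ∈ dom F, θ₁ ≠ θ₂ → ∀ a b : ℝ, 0 < a → 0 < b → a + b = 1 →
    F (a • θ₁ + b • θ₂) < (a : EReal) * F θ₁ + (b : EReal) * F θ₂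

/-- `F` is finite in a neighbourhood of `p`, i.e. `p` lies in the interior of `dom F` for a proper
function `F`, and is differentiable at `p` with gradient `v`. -/
def HasEGradientAt (F : Vec d → EReal) (v p : Vec d) : Prop :=
  (∀ᶠ q in 𝓝 p, F q ≠ ⊤ ∧ F q ≠ ⊥) ∧ HasGradientAt (fun q => (F q).toReal) v p

/-- The gradient of `F`, meaningful at points of the interior of `dom F` where `F` is
differentiable. -/
noncomputable def egradient (F : Vec d → EReal) (p : Vec d) : Vec d :=
  gradient (fun q => (F q).toReal) p

/-- A Legendre function: proper, lower semicontinuous, strictly convex, differentiable on the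
interior of its domain, with a gradient whose norm diverges along every sequence of the interior
that converges to a boundary point of the domain. -/
structure IsLegendre (h : Vec d → EReal) : Prop where
  proper : IsProper h
  lowerSemicontinuous : LowerSemicontinuous h
  strictlyConvex : IsStrictlyConvex h
  differentiable : ∀ p ∈ interior (dom h), HasEGradientAt h (egradient h p) p
  gradient_diverges : ∀ p ∈ frontier (dom h), ∀ u : ℕ → Vec d,
    (∀ k, u k ∈ interior (dom h)) → Tendsto u atTop (𝓝 p) →
      Tendsto (fun k => ‖egradient h (u k)‖) atTop atTop

/-- The convex conjugate `F^*(η) = sup_θ ⟨η, θ⟩ - F(θ)`. -/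
noncomputable def conjugate (F : Vec d → EReal) (η : Vec d) : EReal :=
  ⨆ θ : Vec d, ((inner ℝ η θ : ℝ) : EReal) - F θ

/-- The Bregman divergence `D_h(α, β) = h(α) - h(β) - ⟨∇h(β), α - β⟩`; it is `+∞` when
`h α = +∞`. -/
noncomputable def bregman (h : Vec d → EReal) (α β : Vec d) : EReal :=
  h α - h β - ((inner ℝ (egradient h β) (α - β) : ℝ) : EReal)

/-- The squared Mahalanobis norm `‖v‖_A² = ⟨v, A v⟩`. -/
def mahalanobisSq (A : Matrix (Fin d) (Fin d) ℝ) (v : Vec d) : ℝ :=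
  v.ofLp ⬝ᵥ (A.mulVec v.ofLp)

end ConvexAnalysis

section LeastSquares

variable {d : ℕ} {Ω : Type*} [MeasurableSpace Ω]

/-- The matrix `E[u ⊗ u]` of a random vector `u`. -/
noncomputable def secondMoment (P : Measure Ω) (u : Ω → Vec d) : Matrix (Fin d) (Fin d) ℝ :=
  Matrix.of fun i j => ∫ ω, u ω i * u ω j ∂P

/-- The least-squares risk `f(θ) = ½ E (⟨x, θ⟩ - y)²`. -/
noncomputable def risk (P : Measure Ω) (x : Ω → Vec d) (y : Ω → ℝ) (θ : Vec d) : ℝ :=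
  (1 / 2) * ∫ ω, (inner ℝ (x ω) θ - y ω) ^ 2 ∂P

/-- The function `h_n = h + n γ g`. -/
noncomputable def regularized (h g : Vec d → EReal) (γ : ℝ) (n : ℕ) (θ : Vec d) : EReal :=
  h θ + (((n : ℝ) * γ : ℝ) : EReal) * g θ

/-- `(η_n, θ_n)` are the dual and primal iterates of stochastic dual averaging for least-squares
regression with constant step-size `γ`, started at `θ₀`. The observations are indexed from `0`:
the pair used to go from step `n` to step `n + 1` is `(x n, y n)`. -/
structure IsSDA (h g : Vec d → EReal) (γ : ℝ) (x : ℕ → Ω → Vec d) (y : ℕ → Ω → ℝ)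
    (θ₀ : Vec d) (η θ : ℕ → Ω → Vec d) : Prop where
  primal_zero : ∀ ω, θ 0 ω = θ₀
  dual_zero : ∀ ω, η 0 ω = egradient h θ₀
  dual_succ : ∀ n ω,
    η (n + 1) ω = η n ω - (γ * (inner ℝ (x n ω) (θ n ω) - y n ω)) • x n ω
  primal_succ : ∀ n ω,
    HasEGradientAt (conjugate (regularized h g γ (n + 1))) (θ (n + 1) ω) (η (n + 1) ω)

/-- The averaged iterate `(1 / n) ∑_{k = 0}^{n - 1} θ_k`. -/
noncomputable def averaged (θ : ℕ → Ω → Vec d) (n : ℕ) (ω : Ω) : Vec d :=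
  (1 / (n : ℝ)) • ∑ k ∈ Finset.range n, θ k ω

end LeastSquares

end DualAveraging

open DualAveraging

/-! Let `B = S^(1/2)` and `W = B⁻¹`, so that `x` is replaced by the isotropic vector `W x` and the
Mahalanobis norm by `‖B ·‖`. The primal step is `T n e`, the minimizer of `h + nγg - ⟨e, ·⟩`. By
compatibility of `h` with `S`, this objective is `1/L`-strongly convex for `‖B ·‖`.

The stochastic dual iterates `η k` are compared with noiseless ones `e k`, driven by the exact
gradient of `f` from the same start. For the noiseless run, a lower bound on the growth of the
optimal values gives `γ ∑ ½‖B (T k (e k) - θ*)‖² ≤ D_h(θ*, θ₀)` (`sum_norm_sq_noiseless_le`).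

For the gap, put `w = W (η n - e n)` and let `r` be the accumulated primal gap `∑ B (T k (η k) - T k
(e k))`. Then `w + γr` is a martingale, so its second moment sees only the noise. In `‖w‖²`, the
cross term with the new primal gap `δ` is dissipative: `‖δ‖² ≤ L⟨w, δ⟩`. In the potential `‖w‖² + ‖w
+ γr‖²` this dissipation absorbs all multiplicative noise proportional to `‖δ‖²` when `γ` is small.
What remains is the noise at the noiseless iterate, whose sum is already controlled
(`lintegral_potential_step_le`, `lintegral_coupling_le`). Since `γr = (w + γr) - w`, the potential
bounds `r`, hence the averaged iterate. -/

namespace DualAveraging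

/-! ### Whitening by the square root of the covariance. -/

section Whitening

variable {d : ℕ}

theorem mahalanobisSq_eq_inner (S : Matrix (Fin d) (Fin d) ℝ) (v : Vec d) :
    mahalanobisSq S v = inner ℝ v (Matrix.toEuclideanCLM (𝕜 := ℝ) S v) := by
  rw [mahalanobisSq, EuclideanSpace.inner_eq_star_dotProduct, Matrix.ofLp_toEuclideanCLM,
    dotProduct_comm]
  simp

/-- A positive definite matrix is `B * B` for a symmetric `B`, and `W` is the inverse of `B`. -/
theorem exists_whitening {S : Matrix (Fin d) (Fin d) ℝ} (hS : S.PosSemidef) (hu : IsUnit S) :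
    ∃ B W : Vec d →L[ℝ] Vec d, (∀ v, mahalanobisSq S v = ‖B v‖ ^ 2) ∧
      ∀ a b, inner ℝ (W a) (B b) = (inner ℝ a b : ℝ) := by
  open scoped MatrixOrder in
  have hsq : CFC.sqrt S * CFC.sqrt S = S := CFC.sqrt_mul_sqrt_self _ hS.nonneg
  set R := CFC.sqrt S with hR
  have hsa : IsSelfAdjoint R := by
    open scoped MatrixOrder in
    exact (CFC.sqrt_nonneg S).isSelfAdjoint
  have hRu : IsUnit R := by
    rw [Matrix.isUnit_iff_isUnit_det] at hu ⊢
    rw [← hsq, Matrix.det_mul] at hu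
    exact isUnit_of_mul_isUnit_left hu
  have hdet : IsUnit R.det := (Matrix.isUnit_iff_isUnit_det R).1 hRu
  have hadj : ∀ a b : Vec d, inner ℝ a (Matrix.toEuclideanCLM (𝕜 := ℝ) R b)
      = (inner ℝ (Matrix.toEuclideanCLM (𝕜 := ℝ) R a) b : ℝ) := by
    intro a b
    have h1 : IsSelfAdjoint (Matrix.toEuclideanCLM (𝕜 := ℝ) R) := hsa.map _
    rw [← ContinuousLinearMap.adjoint_inner_left, h1.adjoint_eq]
  refine ⟨Matrix.toEuclideanCLM (𝕜 := ℝ) R, Matrix.toEuclideanCLM (𝕜 := ℝ) R⁻¹, ?_, ?_⟩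
  · intro v
    rw [mahalanobisSq_eq_inner, ← hsq, map_mul, mul_apply_eq_comp, hadj,
      real_inner_self_eq_norm_sq]
  · intro a b
    rw [hadj, ← mul_apply_eq_comp, ← map_mul, Matrix.mul_nonsing_inv _ hdet, map_one]
    simp

variable {B W : Vec d →L[ℝ] Vec d}

theorem norm_le_of_whitening (hWB : ∀ a b, inner ℝ (W a) (B b) = (inner ℝ a b : ℝ)) (b : Vec d) :
    ‖b‖ ≤ ‖W‖ * ‖B b‖ := by
  rcases eq_or_ne b 0 with rfl | hb
  · simp
  have hb' : 0 < ‖b‖ := norm_pos_iff.2 hb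
  have h1 : ‖b‖ * ‖b‖ ≤ (‖W‖ * ‖B b‖) * ‖b‖ := by
    calc ‖b‖ * ‖b‖ = inner ℝ (W b) (B b) := by rw [hWB, real_inner_self_eq_norm_mul_norm]
      _ ≤ ‖W b‖ * ‖B b‖ := real_inner_le_norm _ _
      _ ≤ (‖W‖ * ‖b‖) * ‖B b‖ := by gcongr; exact W.le_opNorm b
      _ = _ := by ring
  exact le_of_mul_le_mul_right h1 hb'

theorem surjective_of_whitening
    (hWB : ∀ a b, inner ℝ (W a) (B b) = (inner ℝ a b : ℝ)) : Function.Surjective B := by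
  have hinj : Function.Injective (B : Vec d →ₗ[ℝ] Vec d) := by
    rw [← LinearMap.ker_eq_bot, LinearMap.ker_eq_bot']
    intro m hm
    have := norm_le_of_whitening hWB m
    rw [show B m = 0 from hm] at this
    simpa using this
  exact LinearMap.injective_iff_surjective.1 hinj

/-- Turns the whitened gradient of the risk, `W` applied to `B* B (p - θS)`, into `B (p - θS)`. -/
theorem whitening_adjoint (hWB : ∀ a b, inner ℝ (W a) (B b) = (inner ℝ a b : ℝ)) (a : Vec d) :
    W (ContinuousLinearMap.adjoint B a) = a := by
  refine ext_inner_right ℝ fun v => ?_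
  obtain ⟨b, rfl⟩ := surjective_of_whitening hWB v
  rw [hWB, ContinuousLinearMap.adjoint_inner_left]

end Whitening

/-! ### Strong convexity relative to `‖B ·‖` and growth at minimizers. -/

section StrongConvexity

variable {d : ℕ}

/-- `φ` is `1 / L`-strongly convex on `D` for the seminorm `‖B ·‖`. -/
def StronglyConvexFor (B : Vec d →L[ℝ] Vec d) (L : ℝ) (D : Set (Vec d)) (φ : Vec d → ℝ) : Prop :=
  ∀ p ∈ D, ∀ q ∈ D, ∀ a b : ℝ, 0 < a → 0 < b → a + b = 1 →
    a • p + b • q ∈ D ∧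
      φ (a • p + b • q) + a * b * (1 / (2 * L) * ‖B (p - q)‖ ^ 2) ≤ a * φ p + b * φ q

/-- `u` minimizes `φ` on `D`, with a quadratic growth of modulus `1 / L`. -/
def IsStrongMin (B : Vec d →L[ℝ] Vec d) (L : ℝ) (D : Set (Vec d)) (φ : Vec d → ℝ) (u : Vec d) :
    Prop :=
  u ∈ D ∧ ∀ p ∈ D, φ u + 1 / (2 * L) * ‖B (p - u)‖ ^ 2 ≤ φ p

variable {B W : Vec d →L[ℝ] Vec d} {L : ℝ} {D : Set (Vec d)} {φ : Vec d → ℝ}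

/-- Minimality is tested at `t p + (1 - t) u`; dividing by `t` leaves the factor `1 - t` on the
quadratic term, which tends to `1` as `t → 0⁺`. -/
theorem StronglyConvexFor.isStrongMin (hφ : StronglyConvexFor B L D φ) {u : Vec d} (hu : u ∈ D)
    (hmin : ∀ p ∈ D, φ u ≤ φ p) : IsStrongMin B L D φ u := by
  refine ⟨hu, fun p hp => ?_⟩
  set K := 1 / (2 * L) * ‖B (p - u)‖ ^ 2 with hK
  have key : ∀ t : ℝ, 0 < t → t < 1 → φ u + (1 - t) * K ≤ φ p := by
    intro t ht ht1
    obtain ⟨h1, h2⟩ := hφ p hp u hu t (1 - t) ht (by linarith) (by ring)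
    have h3 := hmin _ h1
    rw [← hK] at h2
    have h4 : t * (φ u + (1 - t) * K) ≤ t * φ p := by nlinarith
    exact le_of_mul_le_mul_left h4 ht
  have hlim : Tendsto (fun t : ℝ => φ u + (1 - t) * K) (𝓝[>] 0) (𝓝 (φ u + (1 - 0) * K)) := by
    refine Tendsto.mono_left (Continuous.tendsto ?_ 0) nhdsWithin_le_nhds
    fun_prop
  have := le_of_tendsto hlim (by
    filter_upwards [Ioo_mem_nhdsGT (show (0 : ℝ) < 1 by norm_num)] with t ht
    exact key t ht.1 ht.2)
  simpa using this

theorem StronglyConvexFor.sub_inner (hφ : StronglyConvexFor B L D φ) (e : Vec d) :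
    StronglyConvexFor B L D fun p => φ p - inner ℝ e p := by
  intro p hp q hq a b ha hb hab
  obtain ⟨h1, h2⟩ := hφ p hp q hq a b ha hb hab
  refine ⟨h1, ?_⟩
  simp only [inner_add_right, inner_smul_right]
  linarith

/-- A point where a strongly convex function has gradient `v` minimizes `φ - ⟨v, ·⟩`. -/
theorem StronglyConvexFor.isStrongMin_of_hasGradientAt (hL : 0 < L)
    (hφ : StronglyConvexFor B L D φ) {u v : Vec d}
    (hu : u ∈ D) (hv : HasGradientAt φ v u) :
    IsStrongMin B L D (fun p => φ p - inner ℝ v p) u := by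
  refine (hφ.sub_inner v).isStrongMin hu fun p hp => ?_
  -- Along the segment from `u` to `p`, convexity bounds every slope by `φ p - φ u`, and the slopes
  -- tend to `⟨v, p - u⟩`.
  have hline : HasDerivAt (fun t : ℝ => φ (u + t • (p - u))) (inner ℝ v (p - u)) 0 := by
    have h1 : HasDerivAt (fun t : ℝ => u + t • (p - u)) (p - u) 0 := by
      simpa using ((hasDerivAt_id (0 : ℝ)).smul_const (p - u)).const_add u
    have h2 := hv.hasFDerivAt
    rw [show u = u + (0 : ℝ) • (p - u) by simp] at h2
    have h3 := h2.comp_hasDerivAt (0 : ℝ) h1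
    rw [InnerProductSpace.toDual_apply_apply] at h3
    exact h3
  have hs : Tendsto (slope (fun t : ℝ => φ (u + t • (p - u))) 0) (𝓝[>] 0)
      (𝓝 (inner ℝ v (p - u))) :=
    hline.tendsto_slope.mono_left (nhdsWithin_mono (0 : ℝ) (fun t (ht : 0 < t) => ht.ne'))
  have := le_of_tendsto hs (b := φ p - φ u) (by
    filter_upwards [Ioo_mem_nhdsGT (show (0 : ℝ) < 1 by norm_num)] with t ht
    obtain ⟨-, h2⟩ := hφ p hp u hu t (1 - t) ht.1 (by linarith [ht.2]) (by ring)
    rw [show t • p + (1 - t) • u = u + t • (p - u) by module] at h2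
    have h3 : 0 ≤ t * (1 - t) * (1 / (2 * L) * ‖B (p - u)‖ ^ 2) :=
      mul_nonneg (mul_nonneg ht.1.le (by linarith [ht.2])) (by positivity)
    rw [slope_def_field, sub_zero, div_le_iff₀ ht.1]
    simp only [zero_smul, add_zero]
    nlinarith)
  rw [inner_sub_right] at this
  linarith

/-- The minimizer of a strongly convex function is strongly monotone in the linear tilt. -/
theorem IsStrongMin.monotone_tilt (hL : 0 < L) {e e' u u' : Vec d}
    (h : IsStrongMin B L D (fun p => φ p - inner ℝ e p) u)
    (h' : IsStrongMin B L D (fun p => φ p - inner ℝ e' p) u') :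
    ‖B (u - u')‖ ^ 2 ≤ L * inner ℝ (e - e') (u - u') := by
  -- Each minimizer is tested against the other; in the sum the values of `φ` cancel and the two
  -- growth terms add up to `1/L`.
  have h1 := h.2 u' h'.1
  have h2 := h'.2 u h.1
  have h3 : ‖B (u' - u)‖ ^ 2 = ‖B (u - u')‖ ^ 2 := by
    rw [← neg_sub, map_neg, norm_neg]
  simp only [inner_sub_left, inner_sub_right]
  rw [h3] at h1
  have h4 : 1 / (2 * L) * ‖B (u - u')‖ ^ 2 * (2 * L) = ‖B (u - u')‖ ^ 2 := by field_simp
  nlinarith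

end StrongConvexity

end DualAveraging

namespace DualAveraging

/-! ### The regularized objective `h + nγg` and its minimizers. -/

section Regularized

variable {d : ℕ}

/-- The effective domain of `h + n γ g` for `g ≥ 0` and `γ > 0`. -/
def feasible (h g : Vec d → EReal) (n : ℕ) : Set (Vec d) :=
  {p | h p ≠ ⊤ ∧ (n ≠ 0 → g p ≠ ⊤)}

/-- The real values of `h + n γ g` on its domain. -/
noncomputable def regularizedReal (h g : Vec d → EReal) (γ : ℝ) (n : ℕ) (p : Vec d) : ℝ :=
  (h p).toReal + n * γ * (g p).toReal

variable {h g : Vec d → EReal} {γ L : ℝ} {B W : Vec d →L[ℝ] Vec d}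

theorem feasible_succ_subset (n : ℕ) : feasible h g (n + 1) ⊆ feasible h g n :=
  fun _ hp => ⟨hp.1, fun _ => hp.2 n.succ_ne_zero⟩

theorem ne_bot_of_nonneg (hg : ∀ p, 0 ≤ g p) (p : Vec d) : g p ≠ ⊥ :=
  fun hb => by simpa [hb] using hg p

theorem regularized_of_mem (hbot : ∀ p, h p ≠ ⊥) (hg : ∀ p, 0 ≤ g p) {n : ℕ} {p : Vec d}
    (hp : p ∈ feasible h g n) :
    regularized h g γ n p = ((regularizedReal h g γ n p : ℝ) : EReal) := by
  rw [regularized, regularizedReal, EReal.coe_add, EReal.coe_toReal hp.1 (hbot p)]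
  rcases eq_or_ne n 0 with rfl | hn
  · simp
  · rw [EReal.coe_mul ((n : ℝ) * γ), EReal.coe_toReal (hp.2 hn) (ne_bot_of_nonneg hg p)]

theorem regularized_of_notMem (hbot : ∀ p, h p ≠ ⊥) (hg : ∀ p, 0 ≤ g p) (hγ : 0 < γ) {n : ℕ}
    {p : Vec d} (hp : p ∉ feasible h g n) : regularized h g γ n p = ⊤ := by
  have hnn : 0 ≤ (((n : ℝ) * γ : ℝ) : EReal) * g p :=
    mul_nonneg (EReal.coe_nonneg.2 (by positivity)) (hg p)
  have hnb : (((n : ℝ) * γ : ℝ) : EReal) * g p ≠ ⊥ := fun hb =>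
    absurd (hb ▸ hnn) (by simp)
  rw [regularized]
  by_cases h1 : h p = ⊤
  · rw [h1, EReal.top_add_of_ne_bot hnb]
  · have : n ≠ 0 ∧ g p = ⊤ := by
      by_contra hc
      exact hp ⟨h1, fun hn hgp => hc ⟨hn, hgp⟩⟩
    have hpos : (0 : ℝ) < (n : ℝ) * γ := mul_pos (by exact_mod_cast Nat.pos_of_ne_zero this.1) hγ
    rw [this.2, EReal.coe_mul_top_of_pos hpos, EReal.add_top_of_ne_bot (hbot p)]

theorem norm_sq_convex_comb (p q : Vec d) {a b : ℝ} (hab : a + b = 1) :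
    ‖B (a • p + b • q)‖ ^ 2 + a * b * ‖B (p - q)‖ ^ 2 = a * ‖B p‖ ^ 2 + b * ‖B q‖ ^ 2 := by
  obtain rfl : b = 1 - a := by linarith
  simp only [map_add, map_smul, map_sub]
  rw [norm_add_sq_real, norm_sub_sq_real, norm_smul, norm_smul, inner_smul_left, inner_smul_right,
    mul_pow, mul_pow, Real.norm_eq_abs, Real.norm_eq_abs, sq_abs, sq_abs]
  simp
  ring

/-- The convexity defect of `½‖B ·‖²` is exactly `½ab‖B (p - q)‖²`, so convexity of `Lh - ½‖B ·‖²`,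
divided by `L`, leaves modulus `1/L`. -/
theorem stronglyConvexFor_toReal (hbot : ∀ p, h p ≠ ⊥) (hL : 0 < L)
    (hconv : IsConvex fun p => (L : EReal) * h p - (((1 / 2) * ‖B p‖ ^ 2 : ℝ) : EReal)) :
    StronglyConvexFor B L (dom h) fun p => (h p).toReal := by
  intro p hp q hq a b ha hb hab
  have hc := hconv p q a b ha hb hab
  simp only at hc
  lift h p to ℝ using ⟨hp, hbot p⟩ with r hr
  lift h q to ℝ using ⟨hq, hbot q⟩ with s hs
  have hne : h (a • p + b • q) ≠ ⊤ := by
    intro htop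
    rw [htop, EReal.coe_mul_top_of_pos hL, EReal.top_sub_coe] at hc
    norm_cast at hc
  refine ⟨hne, ?_⟩
  lift h (a • p + b • q) to ℝ using ⟨hne, hbot _⟩ with t ht
  norm_cast at hc
  rw [EReal.toReal_coe, EReal.toReal_coe, EReal.toReal_coe]
  have hid := norm_sq_convex_comb (B := B) p q hab
  have h4 : L * (a * b * (1 / (2 * L) * ‖B (p - q)‖ ^ 2)) = 1 / 2 * (a * b * ‖B (p - q)‖ ^ 2) := by
    field_simp
  refine le_of_mul_le_mul_left ?_ hL
  rw [mul_add, h4]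
  linarith

theorem stronglyConvexFor_regularizedReal (hg : ∀ p, 0 ≤ g p)
    (hgc : IsConvex g) (hγ : 0 < γ)
    (hh : StronglyConvexFor B L (dom h) fun p => (h p).toReal) (n : ℕ) :
    StronglyConvexFor B L (feasible h g n) (regularizedReal h g γ n) := by
  intro p hp q hq a b ha hb hab
  obtain ⟨h1, h2⟩ := hh p hp.1 q hq.1 a b ha hb hab
  rcases eq_or_ne n 0 with rfl | hn
  · refine ⟨⟨h1, fun hn => absurd rfl hn⟩, ?_⟩
    simpa [regularizedReal] using h2
  have hc := hgc p q a b ha hb hab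
  have hpg := hp.2 hn
  have hqg := hq.2 hn
  have hgb := ne_bot_of_nonneg hg
  simp only [regularizedReal]
  lift g p to ℝ using ⟨hpg, hgb p⟩ with r hr
  lift g q to ℝ using ⟨hqg, hgb q⟩ with s hs
  have hne : g (a • p + b • q) ≠ ⊤ := by
    intro htop
    rw [htop] at hc
    norm_cast at hc
  refine ⟨⟨h1, fun _ => hne⟩, ?_⟩
  lift g (a • p + b • q) to ℝ using ⟨hne, hgb _⟩ with t ht
  norm_cast at hc
  simp only [EReal.toReal_coe] at h2 ⊢
  have hpos : (0 : ℝ) ≤ (n : ℝ) * γ := by positivity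
  have := mul_le_mul_of_nonneg_left hc hpos
  linarith

theorem lowerSemicontinuous_regularized (hbot : ∀ p, h p ≠ ⊥) (hg : ∀ p, 0 ≤ g p)
    (hh : LowerSemicontinuous h) (hgl : LowerSemicontinuous g) (hγ : 0 < γ) (n : ℕ) :
    LowerSemicontinuous (regularized h g γ n) := by
  rcases eq_or_ne n 0 with rfl | hn
  · have : regularized h g γ 0 = h := by
      funext p
      simp [regularized]
    rwa [this]
  have hpos : (0 : ℝ) < (n : ℝ) * γ := mul_pos (by exact_mod_cast Nat.pos_of_ne_zero hn) hγ
  have hposE : (0 : EReal) < (((n : ℝ) * γ : ℝ) : EReal) := EReal.coe_pos.2 hpos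
  have hnb : ∀ p, (((n : ℝ) * γ : ℝ) : EReal) * g p ≠ ⊥ := fun p hb =>
    absurd (hb ▸ mul_nonneg hposE.le (hg p)) (by simp)
  have hcont : Continuous fun z : EReal => (((n : ℝ) * γ : ℝ) : EReal) * z := by
    refine continuous_iff_continuousAt.2 fun z => ?_
    exact EReal.Tendsto.const_mul tendsto_id (Or.inl (EReal.coe_ne_bot _))
      (Or.inl (EReal.coe_ne_top _))
  have hmul : LowerSemicontinuous fun p => (((n : ℝ) * γ : ℝ) : EReal) * g p :=
    hcont.comp_lowerSemicontinuous hgl fun x y hxy => mul_le_mul_of_nonneg_left hxy hposE.le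
  exact hh.add' hmul fun p => EReal.continuousAt_add (Or.inr (hnb p)) (Or.inl (hbot p))

/-- Existence of the dual averaging step. -/
theorem exists_isStrongMin (hWB : ∀ a b, inner ℝ (W a) (B b) = (inner ℝ a b : ℝ))
    (hbot : ∀ p, h p ≠ ⊥) (hg : ∀ p, 0 ≤ g p) (hgc : IsConvex g)
    (hh : LowerSemicontinuous h) (hgl : LowerSemicontinuous g) (hγ : 0 < γ) (hL : 0 < L)
    (hsc : StronglyConvexFor B L (dom h) fun p => (h p).toReal)
    {p₀ v₀ : Vec d} (hmin₀ : IsStrongMin B L (dom h) (fun p => (h p).toReal - inner ℝ v₀ p) p₀)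
    (n : ℕ) (hne : (feasible h g n).Nonempty) (e : Vec d) :
    ∃ u, IsStrongMin B L (feasible h g n)
      (fun p => regularizedReal h g γ n p - inner ℝ e p) u := by
  have hscn := (stronglyConvexFor_regularizedReal hg hgc hγ hsc n).sub_inner e
  suffices hs : ∃ u ∈ feasible h g n, ∀ p ∈ feasible h g n,
      regularizedReal h g γ n u - inner ℝ e u ≤ regularizedReal h g γ n p - inner ℝ e p by
    obtain ⟨u, hu, hmin⟩ := hs
    exact ⟨u, hscn.isStrongMin hu hmin⟩
  obtain ⟨q, hq⟩ := hne
  set Λ : Vec d → ℝ := fun p => regularizedReal h g γ n p - inner ℝ e p with hΛ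
  have hW : 0 < ‖W‖ + 1 := by positivity
  set c : ℝ := 1 / (2 * L) / (‖W‖ + 1) ^ 2 with hc
  have hcpos : 0 < c := by positivity
  -- quadratic lower bound
  have hlow : ∀ p ∈ feasible h g n,
      (h p₀).toReal - inner ℝ e p₀ - ‖v₀ - e‖ * ‖p - p₀‖ + c * ‖p - p₀‖ ^ 2 ≤ Λ p := by
    intro p hp
    have h1 := hmin₀.2 p hp.1
    have h2 : c * ‖p - p₀‖ ^ 2 ≤ 1 / (2 * L) * ‖B (p - p₀)‖ ^ 2 := by
      rw [hc, div_mul_eq_mul_div, div_le_iff₀ (by positivity), mul_assoc]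
      refine mul_le_mul_of_nonneg_left ?_ (by positivity)
      rw [← mul_pow]
      refine pow_le_pow_left₀ (norm_nonneg _) ?_ 2
      have := norm_le_of_whitening hWB (p - p₀)
      nlinarith [norm_nonneg (B (p - p₀))]
    have h3 : 0 ≤ (n : ℝ) * γ * (g p).toReal :=
      mul_nonneg (by positivity) (EReal.toReal_nonneg (hg p))
    have h4 : -(‖v₀ - e‖ * ‖p - p₀‖) ≤ inner ℝ (v₀ - e) (p - p₀) :=
      neg_le_of_abs_le (abs_real_inner_le_norm _ _)
    simp only [inner_sub_left, inner_sub_right] at h4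
    simp only [hΛ, regularizedReal]
    linarith
  set A : ℝ := |Λ q - ((h p₀).toReal - inner ℝ e p₀)| with hA
  -- Outside this ball `c‖p - p₀‖ ≥ ‖v₀ - e‖ + A` and `‖p - p₀‖ ≥ 1`, so the lower bound exceeds its
  -- value at `p₀` by at least `A`, hence exceeds `Λ q`. The first entry of the maximum keeps `q` in
  -- the ball.
  set R : ℝ := max ‖q - p₀‖ ((‖v₀ - e‖ + A) / c + 1) with hR
  have hfar : ∀ p ∈ feasible h g n, R < ‖p - p₀‖ → Λ q ≤ Λ p := by
    intro p hp hRp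
    refine le_trans ?_ (hlow p hp)
    have h1 : (‖v₀ - e‖ + A) / c + 1 < ‖p - p₀‖ := lt_of_le_of_lt (le_max_right _ _) hRp
    have hA0 : 0 ≤ A := abs_nonneg _
    have h2 : (‖v₀ - e‖ + A) / c * c = ‖v₀ - e‖ + A := by field_simp
    have h0 : 0 ≤ (‖v₀ - e‖ + A) / c := by positivity
    have h3 : ‖v₀ - e‖ + A ≤ c * ‖p - p₀‖ := by nlinarith
    have h4 : A ≤ A * ‖p - p₀‖ := by nlinarith
    have h5 : (‖v₀ - e‖ + A) * ‖p - p₀‖ ≤ c * ‖p - p₀‖ * ‖p - p₀‖ :=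
      mul_le_mul_of_nonneg_right h3 (norm_nonneg _)
    have h6 := le_abs_self (Λ q - ((h p₀).toReal - inner ℝ e p₀))
    rw [← hA] at h6
    nlinarith
  have hlsc : LowerSemicontinuous fun p => regularized h g γ n p + ((-inner ℝ e p : ℝ) : EReal) := by
    refine (lowerSemicontinuous_regularized hbot hg hh hgl hγ n).add' ?_ ?_
    · refine Continuous.lowerSemicontinuous (continuous_coe_real_ereal.comp ?_)
      fun_prop
    · exact fun p => EReal.continuousAt_add (Or.inr (EReal.coe_ne_bot _))
        (Or.inr (EReal.coe_ne_top _))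
  have hval : ∀ p ∈ feasible h g n,
      regularized h g γ n p + ((-inner ℝ e p : ℝ) : EReal) = ((Λ p : ℝ) : EReal) := by
    intro p hp
    rw [regularized_of_mem hbot hg hp, ← EReal.coe_add, ← sub_eq_add_neg]
  have hqR : q ∈ Metric.closedBall p₀ R := by
    rw [mem_closedBall_iff_norm]
    exact le_max_left _ _
  -- The extended-valued objective is minimized over the compact ball; the finite value at `q` then
  -- forces the minimizer to be feasible.
  obtain ⟨u, huR, hu⟩ := LowerSemicontinuousOn.exists_isMinOn ⟨q, hqR⟩
    (isCompact_closedBall p₀ R) (hlsc.lowerSemicontinuousOn _)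
  have hu' := isMinOn_iff.1 hu
  have huf : u ∈ feasible h g n := by
    by_contra hcon
    have := hu' q hqR
    rw [hval q hq, regularized_of_notMem hbot hg hγ hcon, EReal.top_add_coe, top_le_iff] at this
    exact EReal.coe_ne_top _ this
  have hmem : ∀ p ∈ feasible h g n, p ∈ Metric.closedBall p₀ R → Λ u ≤ Λ p := by
    intro p hp hpR
    have := hu' p hpR
    rwa [hval p hp, hval u huf, EReal.coe_le_coe_iff] at this
  refine ⟨u, huf, fun p hp => ?_⟩
  by_cases hpR : p ∈ Metric.closedBall p₀ R
  · exact hmem p hp hpR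
  · rw [mem_closedBall_iff_norm, not_le] at hpR
    exact (hmem q hq hqR).trans (hfar p hp hpR)

/-- A gradient of the conjugate is the primal minimizer. -/
theorem eq_of_hasEGradientAt_conjugate (hbot : ∀ p, h p ≠ ⊥) (hg : ∀ p, 0 ≤ g p) (hγ : 0 < γ)
    (hL : 0 < L) {n : ℕ} {e u w : Vec d}
    (hu : IsStrongMin B L (feasible h g n) (fun p => regularizedReal h g γ n p - inner ℝ e p) u)
    (hw : HasEGradientAt (conjugate (regularized h g γ n)) w e) : w = u := by
  set G := conjugate (regularized h g γ n) with hG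
  set r := regularizedReal h g γ n u with hr
  have hlow : ∀ e', ((inner ℝ e' u - r : ℝ) : EReal) ≤ G e' := by
    intro e'
    have := le_iSup (fun p : Vec d => ((inner ℝ e' p : ℝ) : EReal) - regularized h g γ n p) u
    simp only [regularized_of_mem hbot hg hu.1] at this
    exact_mod_cast this
  have heq : G e = ((inner ℝ e u - r : ℝ) : EReal) := by
    refine le_antisymm (iSup_le fun p => ?_) (hlow e)
    by_cases hp : p ∈ feasible h g n
    · rw [regularized_of_mem hbot hg hp]
      have h1 := hu.2 p hp
      have h2 : 0 ≤ 1 / (2 * L) * ‖B (p - u)‖ ^ 2 := by positivity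
      have h3 : inner ℝ e p - regularizedReal h g γ n p ≤ inner ℝ e u - r := by linarith
      exact_mod_cast h3
    · rw [regularized_of_notMem hbot hg hγ hp]
      simp
  -- The affine function `⟨·, u⟩ - r` lies below the conjugate and touches it at `e`, so the two
  -- gradients agree there.
  have hmin : IsLocalMin (fun e' => (G e').toReal - inner ℝ u e') e := by
    filter_upwards [hw.1] with e' he'
    have h1 := hlow e'
    rw [← EReal.coe_toReal he'.1 he'.2, EReal.coe_le_coe_iff] at h1
    rw [heq, EReal.toReal_coe, real_inner_comm e u, real_inner_comm e' u]
    linarith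
  have hd : HasFDerivAt (fun e' => (G e').toReal - inner ℝ u e')
      (InnerProductSpace.toDual ℝ (Vec d) w - innerSL ℝ u) e :=
    hw.2.hasFDerivAt.sub (innerSL ℝ u).hasFDerivAt
  have h0 := hmin.hasFDerivAt_eq_zero hd
  refine ext_inner_right ℝ fun v => ?_
  have := congrArg (fun F : Vec d →L[ℝ] ℝ => F v) h0
  simp at this
  linarith

end Regularized

end DualAveraging

namespace DualAveraging

/-! ### Noiseless dual averaging. -/

section NoiselessIterates

variable {d : ℕ} {h g : Vec d → EReal} {γ L : ℝ} {B : Vec d →L[ℝ] Vec d}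

theorem regularizedReal_succ (n : ℕ) (p : Vec d) :
    regularizedReal h g γ (n + 1) p = regularizedReal h g γ n p + γ * (g p).toReal := by
  simp only [regularizedReal]
  push_cast
  ring

/-- The sum of the squared distances to the optimum along the noiseless dual averaging iterates is
controlled by the Bregman divergence. -/
theorem sum_norm_sq_noiseless_le (hγ : 0 < γ) (hL : 0 < L) (hγL : γ * L ≤ 1)
    {e u : ℕ → Vec d} {θS θstar : Vec d} (hmem : h θstar ≠ ⊤) (hgmem : g θstar ≠ ⊤)
    (hmin : ∀ k, IsStrongMin B L (feasible h g k)
      (fun p => regularizedReal h g γ k p - inner ℝ (e k) p) (u k))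
    (he : ∀ k, e (k + 1) = e k - γ • ContinuousLinearMap.adjoint B (B (u k - θS)))
    (hopt : ∀ p ∈ feasible h g 1, (g θstar).toReal + 1 / 2 * ‖B (θstar - θS)‖ ^ 2 ≤
      (g p).toReal + 1 / 2 * ‖B (p - θS)‖ ^ 2) (n : ℕ) :
    γ * ∑ k ∈ Finset.range n, 1 / 2 * ‖B (u k - θstar)‖ ^ 2 ≤
      ((h θstar).toReal - inner ℝ (e 0) θstar) - ((h (u 0)).toReal - inner ℝ (e 0) (u 0)) := by
  have hsub : ∀ k, feasible h g (k + 1) ⊆ feasible h g 1 :=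
    fun k p hp => ⟨hp.1, fun _ => hp.2 k.succ_ne_zero⟩
  have hγL' : γ ≤ 1 / L := by rwa [le_div_iff₀ hL]
  -- Lower bound on the optimal values. At step `k` the optimality of `θstar` is tested at `u (k +
  -- 1)`, which lies in the domain of `g`; `u 0` need not, so `g (u 0)` never enters.
  have hgrow : ∀ m : ℕ, (h (u 0)).toReal - inner ℝ (e 0) (u 0) +
      γ * ∑ k ∈ Finset.range m, ((g θstar).toReal + 1 / 2 * ‖B (u k - θstar)‖ ^ 2 +
        inner ℝ (B (u k - θS)) (B θstar)) ≤
      regularizedReal h g γ m (u m) - inner ℝ (e m) (u m) := by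
    intro m
    induction m with
    | zero => simp [regularizedReal]
    | succ k ih =>
      have h1 := (hmin k).2 (u (k + 1)) (feasible_succ_subset k (hmin (k + 1)).1)
      have h2 := hopt _ (hsub k (hmin (k + 1)).1)
      rw [Finset.sum_range_succ, regularizedReal_succ, he, inner_sub_left, real_inner_smul_left,
        ContinuousLinearMap.adjoint_inner_left]
      set a := B (u k - θS) with ha
      set p := B (u (k + 1) - u k) with hp
      have e1 : B (u (k + 1) - θS) = p + a := by rw [hp, ha, ← map_add]; congr 1; abel
      have e2 : B (θstar - θS) = a - B (u k - θstar) := by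
        rw [ha, ← map_sub]; congr 1; abel
      have e3 : B θstar = B (u (k + 1)) - p - B (u k - θstar) := by
        rw [hp, ← map_sub, ← map_sub]; congr 1; abel
      rw [e1, e2, norm_add_sq_real, norm_sub_sq_real] at h2
      rw [show (inner ℝ a (B θstar) : ℝ) = inner ℝ a (B (u (k + 1))) - inner ℝ a p -
        inner ℝ a (B (u k - θstar)) by rw [e3, inner_sub_right, inner_sub_right]]
      rw [real_inner_comm a p] at h2
      -- The movement term `‖p‖²`, the error of using the gradient at `u k` instead of `u (k + 1)`,
      -- is absorbed by strong convexity because `γL ≤ 1`.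
      have h3 : γ / 2 * ‖p‖ ^ 2 ≤ 1 / (2 * L) * ‖p‖ ^ 2 := by
        refine mul_le_mul_of_nonneg_right ?_ (sq_nonneg _)
        calc γ / 2 ≤ 1 / L / 2 := by linarith
          _ = _ := by field_simp
      have h4 := mul_le_mul_of_nonneg_left h2 hγ.le
      linarith
  have hdual : ∀ m : ℕ, inner ℝ (e m) θstar = inner ℝ (e 0) θstar -
      γ * ∑ k ∈ Finset.range m, inner ℝ (B (u k - θS)) (B θstar) := by
    intro m
    induction m with
    | zero => simp
    | succ k ih =>
      rw [he, inner_sub_left, real_inner_smul_left, ContinuousLinearMap.adjoint_inner_left, ih,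
        Finset.sum_range_succ]
      ring
  have h1 := hgrow n
  -- The value at `θstar` bounds the `n`-th optimal value from above; the terms in `g θstar` and the
  -- linear terms cancel against `hgrow`.
  have h2 := (hmin n).2 θstar ⟨hmem, fun _ => hgmem⟩
  have h3 : 0 ≤ 1 / (2 * L) * ‖B (θstar - u n)‖ ^ 2 := by positivity
  simp only [regularizedReal, hdual n] at h2
  simp only [Finset.sum_add_distrib, Finset.sum_const, Finset.card_range, nsmul_eq_mul] at h1
  simp only [regularizedReal] at h1
  linarith

end NoiselessIterates

/-! ### One-step drift of the coupled potential. -/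

section Drift

variable {d : ℕ} {Ω : Type*} [MeasurableSpace Ω] {P : Measure Ω} [IsProbabilityMeasure P]

theorem integral_inner_of_memLp {v : Ω → Vec d} (hv : MemLp v 2 P) (a : Vec d) :
    Integrable (fun ω => (inner ℝ (v ω) a : ℝ)) P :=
  (hv.integrable (by norm_num)).inner_const a

/-- The second-order behaviour of a whitened stochastic gradient. -/
theorem whitened_gradient_moments {X : Ω → Vec d} {ε : Ω → ℝ} {K V : ℝ} (hX : MemLp X 2 P)
    (hcov : ∀ a b, ∫ ω, (inner ℝ (X ω) a * inner ℝ (X ω) b : ℝ) ∂P = inner ℝ a b)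
    (hK : ∀ a, MemLp (fun ω => (inner ℝ (X ω) a : ℝ) • X ω) 2 P ∧
      ∫ ω, ‖(inner ℝ (X ω) a : ℝ) • X ω‖ ^ 2 ∂P ≤ K * ‖a‖ ^ 2)
    (hε : MemLp (fun ω => ε ω • X ω) 2 P) (hεV : ∫ ω, ‖ε ω • X ω‖ ^ 2 ∂P ≤ V)
    (hε0 : ∀ a, ∫ ω, (inner ℝ (ε ω • X ω) a : ℝ) ∂P = 0) (δ c : Vec d) {v : Ω → Vec d}
    (hv : v = fun ω => (inner ℝ (X ω) δ : ℝ) • X ω + (inner ℝ (X ω) c : ℝ) • X ω - c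
      - ε ω • X ω) :
    MemLp v 2 P ∧ (∀ a, ∫ ω, (inner ℝ (v ω) a : ℝ) ∂P = inner ℝ δ a) ∧
      ∫ ω, ‖v ω‖ ^ 2 ∂P ≤ 2 * K * ‖δ‖ ^ 2 + 4 * (K * ‖c‖ ^ 2 + V) := by
  have hmem : MemLp v 2 P := by
    rw [hv]
    exact (((hK δ).1.add (hK c).1).sub (memLp_const c)).sub hε
  refine ⟨hmem, fun a => ?_, ?_⟩
  · have hI := fun b => integral_inner_of_memLp (hK b).1 a
    have hIε := integral_inner_of_memLp hε a
    have hmean : ∀ b, ∫ ω, (inner ℝ ((inner ℝ (X ω) b : ℝ) • X ω) a : ℝ) ∂P = inner ℝ b a := by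
      intro b
      simp only [real_inner_smul_left]
      exact hcov b a
    simp only [hv, inner_sub_left, inner_add_left]
    have hI1 : Integrable (fun ω => (inner ℝ ((inner ℝ (X ω) δ : ℝ) • X ω) a +
        inner ℝ ((inner ℝ (X ω) c : ℝ) • X ω) a : ℝ)) P := (hI δ).add (hI c)
    have hI2 : Integrable (fun ω => (inner ℝ ((inner ℝ (X ω) δ : ℝ) • X ω) a +
        inner ℝ ((inner ℝ (X ω) c : ℝ) • X ω) a - inner ℝ c a : ℝ)) P :=
      hI1.sub (integrable_const _)
    rw [integral_sub hI2 hIε, integral_sub hI1 (integrable_const _), integral_add (hI δ) (hI c),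
      hmean, hmean, hε0]
    simp
  · have hIc : Integrable (fun ω => (inner ℝ (X ω) c * inner ℝ (X ω) c : ℝ)) P :=
      (hX.inner_const c).integrable_mul (hX.inner_const c)
    have hsq := fun b => (hK b).1.integrable_norm_pow (by norm_num)
    have hsε := hε.integrable_norm_pow (by norm_num)
    -- Two uses of `‖p + q‖² ≤ 2‖p‖² + 2‖q‖²` give the factors 2 and 4. The cross term integrates to
    -- `-8‖c‖²` and outweighs `4‖c‖²`: centring costs nothing.
    have hle : ∀ ω, ‖v ω‖ ^ 2 ≤ 2 * ‖(inner ℝ (X ω) δ : ℝ) • X ω‖ ^ 2 +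
        (4 * ‖(inner ℝ (X ω) c : ℝ) • X ω‖ ^ 2 - 8 * (inner ℝ (X ω) c * inner ℝ (X ω) c)
          + 4 * ‖c‖ ^ 2) + 4 * ‖ε ω • X ω‖ ^ 2 := by
      intro ω
      have par : ∀ p q : Vec d, ‖p + q‖ ^ 2 ≤ 2 * ‖p‖ ^ 2 + 2 * ‖q‖ ^ 2 := by
        intro p q
        have := parallelogram_law_with_norm ℝ p q
        nlinarith [sq_nonneg ‖p - q‖]
      have h1 := par ((inner ℝ (X ω) δ : ℝ) • X ω) (((inner ℝ (X ω) c : ℝ) • X ω - c)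
        + -(ε ω • X ω))
      have h2 := par ((inner ℝ (X ω) c : ℝ) • X ω - c) (-(ε ω • X ω))
      rw [norm_neg, norm_sub_sq_real, real_inner_smul_left] at h2
      have h3 : v ω = (inner ℝ (X ω) δ : ℝ) • X ω + (((inner ℝ (X ω) c : ℝ) • X ω - c)
        + -(ε ω • X ω)) := by
        simp only [hv]
        abel
      rw [h3]
      linarith
    have hI1 : Integrable (fun ω => 4 * ‖(inner ℝ (X ω) c : ℝ) • X ω‖ ^ 2 -
        8 * (inner ℝ (X ω) c * inner ℝ (X ω) c)) P := ((hsq c).const_mul 4).sub (hIc.const_mul 8)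
    have hI2 : Integrable (fun ω => 4 * ‖(inner ℝ (X ω) c : ℝ) • X ω‖ ^ 2 -
        8 * (inner ℝ (X ω) c * inner ℝ (X ω) c) + 4 * ‖c‖ ^ 2) P := hI1.add (integrable_const _)
    have hI3 : Integrable (fun ω => 2 * ‖(inner ℝ (X ω) δ : ℝ) • X ω‖ ^ 2 +
        (4 * ‖(inner ℝ (X ω) c : ℝ) • X ω‖ ^ 2 - 8 * (inner ℝ (X ω) c * inner ℝ (X ω) c)
          + 4 * ‖c‖ ^ 2)) P := ((hsq δ).const_mul 2).add hI2
    refine (integral_mono (hmem.integrable_norm_pow (by norm_num))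
      (hI3.add (hsε.const_mul 4)) hle).trans ?_
    · rw [Pi.add_def, integral_add hI3 (hsε.const_mul 4), integral_add ((hsq δ).const_mul 2) hI2,
        integral_add hI1 (integrable_const _),
        integral_sub ((hsq c).const_mul 4) (hIc.const_mul 8)]
      simp only [integral_const_mul, integral_const, probReal_univ, one_smul]
      rw [hcov c c, real_inner_self_eq_norm_sq]
      have h1 := (hK δ).2
      have h2 := (hK c).2
      nlinarith [sq_nonneg ‖c‖]

/-- One step of the coupled dynamics does not increase the potential `‖w‖² + ‖w + γ r‖²` by more
than the variance of the noise at the noiseless iterate. -/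
theorem lintegral_potential_step_le {γ L K V : ℝ} (hγ : 0 < γ) (hL : 0 < L)
    (hγK : 2 * γ * K * L ≤ 1) {v : Ω → Vec d} {δ c w : Vec d} (r : Vec d) (hv : MemLp v 2 P)
    (hmean : ∀ a, ∫ ω, (inner ℝ (v ω) a : ℝ) ∂P = inner ℝ δ a)
    (hvar : ∫ ω, ‖v ω‖ ^ 2 ∂P ≤ 2 * K * ‖δ‖ ^ 2 + 4 * (K * ‖c‖ ^ 2 + V))
    (hmono : ‖δ‖ ^ 2 ≤ L * inner ℝ w δ) :
    ∫⁻ ω, ENNReal.ofReal (‖w - γ • v ω‖ ^ 2 + ‖(w - γ • v ω) + γ • (r + δ)‖ ^ 2) ∂P ≤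
      ENNReal.ofReal (‖w‖ ^ 2 + ‖w + γ • r‖ ^ 2 + 8 * γ ^ 2 * (K * ‖c‖ ^ 2 + V)) := by
  set y := w + γ • r with hy
  set z : Vec d := (-2 * γ) • w + (-2 * γ) • y + (-2 * γ ^ 2) • δ with hz
  set C : ℝ := ‖w‖ ^ 2 + ‖y‖ ^ 2 + 2 * γ * inner ℝ δ y + γ ^ 2 * ‖δ‖ ^ 2 with hC
  have hexp : ∀ ω, ‖w - γ • v ω‖ ^ 2 + ‖(w - γ • v ω) + γ • (r + δ)‖ ^ 2 =
      C + inner ℝ (v ω) z + 2 * γ ^ 2 * ‖v ω‖ ^ 2 := by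
    intro ω
    -- The second component moves only by the centred noise `v - δ`.
    rw [show (w - γ • v ω) + γ • (r + δ) = y - γ • (v ω - δ) by rw [hy]; module,
      norm_sub_sq_real, norm_sub_sq_real, norm_smul, norm_smul, mul_pow, mul_pow,
      norm_sub_sq_real, Real.norm_eq_abs, sq_abs, hC, hz]
    simp only [inner_add_right, real_inner_smul_right, inner_sub_right]
    rw [real_inner_comm w (v ω), real_inner_comm y (v ω), real_inner_comm y δ]
    ring
  have hI1 := integral_inner_of_memLp hv z
  have hI2 : Integrable (fun ω => ‖v ω‖ ^ 2) P := hv.integrable_norm_pow (by norm_num)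
  have hI : Integrable (fun ω => C + inner ℝ (v ω) z + 2 * γ ^ 2 * ‖v ω‖ ^ 2) P :=
    ((integrable_const C).add hI1).add (hI2.const_mul _)
  rw [lintegral_congr fun ω => by rw [hexp ω], ← ofReal_integral_eq_lintegral_ofReal hI
    (ae_of_all _ fun ω => by
      simp only [Pi.zero_apply]
      rw [← hexp ω]
      positivity)]
  refine ENNReal.ofReal_le_ofReal ?_
  have hI3 : Integrable (fun ω => C + inner ℝ (v ω) z) P := (integrable_const C).add hI1
  rw [integral_add hI3 (hI2.const_mul _),
    integral_add (integrable_const C) hI1, integral_const_mul, hmean, integral_const,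
    probReal_univ, one_smul, hC, hz]
  simp only [inner_add_right, real_inner_smul_right, real_inner_self_eq_norm_sq]
  rw [real_inner_comm w δ] at *
  have h1 := mul_le_mul_of_nonneg_left hvar (show 0 ≤ 2 * γ ^ 2 by positivity)
  -- The multiplicative noise enters twice, once per component, and is dominated by the dissipation
  -- `2γ⟨w, δ⟩`; this is where `2γKL ≤ 1` is needed.
  have h2 : 4 * γ ^ 2 * K * ‖δ‖ ^ 2 ≤ 2 * γ * inner ℝ w δ := by
    refine le_of_mul_le_mul_left ?_ hL
    have h3 := mul_le_mul_of_nonneg_right hγK (show 0 ≤ 2 * γ * ‖δ‖ ^ 2 by positivity)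
    have h4 := mul_le_mul_of_nonneg_left hmono (show 0 ≤ 2 * γ by positivity)
    linarith
  have h5 : 0 ≤ γ ^ 2 * ‖δ‖ ^ 2 := by positivity
  nlinarith

end Drift

end DualAveraging

namespace DualAveraging

/-! ### Recursions driven by i.i.d. noise. -/

section RandomRecursion

variable {Ω E Γ : Type*} [MeasurableSpace E] [MeasurableSpace Γ]

/-- Freezing: the joint law is a product, so the noise may be integrated first with `Z` fixed, and
`Y` replaced by any copy of the same law. -/
theorem lintegral_indepFun [MeasurableSpace Ω] {P : Measure Ω} [IsProbabilityMeasure P]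
    {Z : Ω → E} {Y Y' : Ω → Γ} (hZ : Measurable Z) (hY : Measurable Y)
    (hind : IndepFun Z Y P) (hid : IdentDistrib Y Y' P P) {F : E × Γ → ℝ≥0∞} (hF : Measurable F) :
    ∫⁻ ω, F (Z ω, Y ω) ∂P = ∫⁻ ω, ∫⁻ ω', F (Z ω, Y' ω') ∂P ∂P := by
  have hprod := (indepFun_iff_map_prod_eq_prod_map_map hZ.aemeasurable hY.aemeasurable).1 hind
  have hpm : IsProbabilityMeasure (P.map Y) := Measure.isProbabilityMeasure_map hY.aemeasurable
  calc ∫⁻ ω, F (Z ω, Y ω) ∂P = ∫⁻ p, F p ∂(P.map fun ω => (Z ω, Y ω)) :=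
        (lintegral_map hF (hZ.prodMk hY)).symm
    _ = ∫⁻ e, ∫⁻ y, F (e, y) ∂(P.map Y) ∂(P.map Z) := by
        rw [hprod, lintegral_prod _ hF.aemeasurable]
    _ = ∫⁻ ω, ∫⁻ y, F (Z ω, y) ∂(P.map Y) ∂P := by
        rw [lintegral_map hF.lintegral_prod_right' hZ]
    _ = ∫⁻ ω, ∫⁻ ω', F (Z ω, Y' ω') ∂P ∂P := by
        refine lintegral_congr fun ω => ?_
        rw [hid.map_eq]
        exact lintegral_map' (hF.comp measurable_prodMk_left).aemeasurable hid.aemeasurable_snd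

variable {z : ℕ → Ω → Γ} {s : ℕ → Ω → E} {s₀ : E} {F : ℕ → E → Γ → E}

theorem exists_factor_of_recursion (hF : ∀ n, Measurable fun p : E × Γ => F n p.1 p.2)
    (hs0 : ∀ ω, s 0 ω = s₀) (hs : ∀ n ω, s (n + 1) ω = F n (s n ω) (z n ω)) (n : ℕ) :
    ∃ G : (Finset.range n → Γ) → E, Measurable G ∧
      ∀ ω, s n ω = G fun i => z i ω := by
  induction n with
  | zero => exact ⟨fun _ => s₀, measurable_const, hs0⟩
  | succ n ih =>
    obtain ⟨G, hG, hGs⟩ := ih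
    refine ⟨fun w => F n (G fun i => w ⟨i, Finset.mem_range.2
      ((Finset.mem_range.1 i.2).trans n.lt_succ_self)⟩) (w ⟨n, Finset.self_mem_range_succ n⟩),
      ?_, fun ω => ?_⟩
    · refine (hF n).comp (Measurable.prodMk (hG.comp ?_) (measurable_pi_apply _))
      exact measurable_pi_lambda _ fun i => measurable_pi_apply _
    · rw [hs, hGs]

/-- The `n`-th state is a measurable function of the noise with indices below `n`. -/
theorem measurable_and_indepFun_of_recursion [MeasurableSpace Ω] {P : Measure Ω}
    (hF : ∀ n, Measurable fun p : E × Γ => F n p.1 p.2) (hs0 : ∀ ω, s 0 ω = s₀)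
    (hs : ∀ n ω, s (n + 1) ω = F n (s n ω) (z n ω)) (hz : ∀ n, Measurable (z n))
    (hind : iIndepFun z P) (n : ℕ) : Measurable (s n) ∧ IndepFun (s n) (z n) P := by
  obtain ⟨G, hG, hGs⟩ := exists_factor_of_recursion hF hs0 hs n
  have hsn : s n = G ∘ fun ω (i : Finset.range n) => z i ω := funext hGs
  have hdisj : Disjoint (Finset.range n) {n} := by simp
  have h1 := hind.indepFun_finset (Finset.range n) {n} hdisj hz
  refine ⟨?_, ?_⟩
  · rw [hsn]
    exact hG.comp (measurable_pi_lambda _ fun i => hz i)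
  · rw [hsn]
    exact h1.comp (φ := G) (ψ := fun w : (({n} : Finset ℕ) → Γ) => w ⟨n, Finset.mem_singleton_self n⟩)
      hG (measurable_pi_apply _)

/-- A potential with a one-step drift bound, evaluated along a recursion driven by i.i.d. noise. -/
theorem lintegral_potential_le [MeasurableSpace Ω] {P : Measure Ω} [IsProbabilityMeasure P]
    (hF : ∀ n, Measurable fun p : E × Γ => F n p.1 p.2)
    (hs0 : ∀ ω, s 0 ω = s₀) (hs : ∀ n ω, s (n + 1) ω = F n (s n ω) (z n ω))
    (hz : ∀ n, Measurable (z n)) (hind : iIndepFun z P)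
    (hid : ∀ n, IdentDistrib (z n) (z 0) P P) {Φ : ℕ → E → ℝ} (hΦ : ∀ n, Measurable (Φ n))
    (hΦ0 : ∀ n e, 0 ≤ Φ n e) {c : ℕ → ℝ} (hc : ∀ n, 0 ≤ c n)
    (hdrift : ∀ n e, ∫⁻ ω, ENNReal.ofReal (Φ (n + 1) (F n e (z 0 ω))) ∂P ≤
      ENNReal.ofReal (Φ n e + c n)) (n : ℕ) :
    ∫⁻ ω, ENNReal.ofReal (Φ n (s n ω)) ∂P ≤
      ENNReal.ofReal (Φ 0 s₀ + ∑ k ∈ Finset.range n, c k) := by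
  induction n with
  | zero => simp [hs0]
  | succ n ih =>
    obtain ⟨hm, hi⟩ := measurable_and_indepFun_of_recursion hF hs0 hs hz hind n
    have hsum : 0 ≤ ∑ k ∈ Finset.range n, c k := Finset.sum_nonneg fun k _ => hc k
    calc ∫⁻ ω, ENNReal.ofReal (Φ (n + 1) (s (n + 1) ω)) ∂P
        = ∫⁻ ω, ENNReal.ofReal (Φ (n + 1) (F n (s n ω) (z n ω))) ∂P := by simp only [hs]
      _ = ∫⁻ ω, ∫⁻ ω', ENNReal.ofReal (Φ (n + 1) (F n (s n ω) (z 0 ω'))) ∂P ∂P :=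
          lintegral_indepFun hm (hz n) hi (hid n)
            (F := fun p => ENNReal.ofReal (Φ (n + 1) (F n p.1 p.2)))
            (((hΦ (n + 1)).comp (hF n)).ennreal_ofReal)
      _ ≤ ∫⁻ ω, ENNReal.ofReal (Φ n (s n ω) + c n) ∂P := lintegral_mono fun ω => hdrift n _
      _ = ∫⁻ ω, ENNReal.ofReal (Φ n (s n ω)) ∂P + ENNReal.ofReal (c n) := by
          simp only [ENNReal.ofReal_add (hΦ0 n _) (hc n)]
          rw [lintegral_add_right _ measurable_const]
          simp
      _ ≤ ENNReal.ofReal (Φ 0 s₀ + ∑ k ∈ Finset.range n, c k) + ENNReal.ofReal (c n) := by gcongr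
      _ = _ := by
          rw [← ENNReal.ofReal_add (add_nonneg (hΦ0 0 s₀) hsum) (hc n), Finset.sum_range_succ,
            add_assoc]

end RandomRecursion

/-! ### Moments of the least-squares problem. -/

section LeastSquaresMoments

variable {d : ℕ} {Ω : Type*} [MeasurableSpace Ω] {P : Measure Ω}

theorem mahalanobisSq_secondMoment {u : Ω → Vec d} (hu : MemLp u 2 P) (a : Vec d) :
    mahalanobisSq (secondMoment P u) a = ∫ ω, (inner ℝ a (u ω)) ^ 2 ∂P := by
  have hc : ∀ i, MemLp (fun ω => u ω i) 2 P := fun i =>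
    hu.continuousLinearMap_comp (EuclideanSpace.proj (𝕜 := ℝ) i)
  have hI : ∀ i j, Integrable (fun ω => a i * (u ω i * u ω j * a j)) P := fun i j =>
    (((hc i).integrable_mul (hc j)).mul_const _).const_mul _
  have hexp : ∀ ω, (inner ℝ a (u ω) : ℝ) ^ 2 = ∑ i, ∑ j, a i * (u ω i * u ω j * a j) := by
    intro ω
    rw [PiLp.inner_apply, sq, Finset.sum_mul_sum]
    refine Finset.sum_congr rfl fun i _ => Finset.sum_congr rfl fun j _ => ?_
    simp
    ring
  simp only [hexp]
  rw [integral_finsetSum _ fun i _ => integrable_finsetSum _ fun j _ => hI i j]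
  simp only [mahalanobisSq, dotProduct, Matrix.mulVec, secondMoment, Matrix.of_apply,
    Finset.mul_sum]
  refine Finset.sum_congr rfl fun i _ => ?_
  rw [integral_finsetSum _ fun j _ => hI i j]
  refine Finset.sum_congr rfl fun j _ => ?_
  rw [integral_const_mul, integral_mul_const]

theorem posSemidef_secondMoment {u : Ω → Vec d} (hu : MemLp u 2 P) :
    (secondMoment P u).PosSemidef := by
  refine Matrix.PosSemidef.of_dotProduct_mulVec_nonneg ?_ fun a => ?_
  · ext i j
    simp [secondMoment, mul_comm]
  · have := mahalanobisSq_secondMoment hu (WithLp.toLp 2 a)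
    rw [star_trivial]
    change 0 ≤ mahalanobisSq (secondMoment P u) (WithLp.toLp 2 a)
    rw [this]
    exact integral_nonneg fun ω => sq_nonneg _

theorem risk_add {x : Ω → Vec d} {y : Ω → ℝ} (hx : MemLp x 2 P) (hy : MemLp y 2 P)
    (p q : Vec d) :
    risk P x y (p + q) = risk P x y p -
      ∫ ω, (inner ℝ ((y ω - inner ℝ p (x ω)) • x ω) q : ℝ) ∂P +
      1 / 2 * mahalanobisSq (secondMoment P x) q := by
  have hxi : ∀ b : Vec d, MemLp (fun ω => (inner ℝ (x ω) b : ℝ)) 2 P := fun b => hx.inner_const b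
  have hr : MemLp (fun ω => (inner ℝ (x ω) p - y ω : ℝ)) 2 P := (hxi p).sub hy
  have hexp : ∀ ω, (inner ℝ (x ω) (p + q) - y ω : ℝ) ^ 2 = (inner ℝ (x ω) p - y ω) ^ 2 -
      2 * inner ℝ ((y ω - inner ℝ p (x ω)) • x ω) q + (inner ℝ q (x ω)) ^ 2 := by
    intro ω
    rw [inner_add_right, real_inner_smul_left, real_inner_comm (x ω) p, real_inner_comm (x ω) q]
    ring
  have hI1 : Integrable (fun ω => (inner ℝ (x ω) p - y ω : ℝ) ^ 2) P := hr.integrable_sq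
  have hI2 : Integrable (fun ω => (2 * inner ℝ ((y ω - inner ℝ p (x ω)) • x ω) q : ℝ)) P := by
    have := (hr.integrable_mul (hxi q)).const_mul (-2)
    refine this.congr (ae_of_all _ fun ω => ?_)
    simp only [Pi.mul_apply]
    rw [real_inner_smul_left, real_inner_comm (x ω) p]
    ring
  have hI3 : Integrable (fun ω => (inner ℝ q (x ω) : ℝ) ^ 2) P := by
    simpa only [real_inner_comm q] using (hxi q).integrable_sq
  have hI4 : Integrable (fun ω => (inner ℝ (x ω) p - y ω) ^ 2 -
      2 * inner ℝ ((y ω - inner ℝ p (x ω)) • x ω) q) P := hI1.sub hI2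
  rw [mahalanobisSq_secondMoment hx, risk, risk]
  simp only [hexp]
  rw [integral_add hI4 hI3, integral_sub hI1 hI2, integral_const_mul]
  ring

/-- The normal equations. -/
theorem integral_residual_eq_zero {x : Ω → Vec d} {y : Ω → ℝ} (hx : MemLp x 2 P)
    (hy : MemLp y 2 P) {θS : Vec d} (hθS : ∀ θ, risk P x y θS ≤ risk P x y θ) (a : Vec d) :
    ∫ ω, (inner ℝ ((y ω - inner ℝ θS (x ω)) • x ω) a : ℝ) ∂P = 0 := by
  set l := ∫ ω, (inner ℝ ((y ω - inner ℝ θS (x ω)) • x ω) a : ℝ) ∂P with hl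
  set q := mahalanobisSq (secondMoment P x) a with hq
  have hq0 : 0 ≤ q := by
    rw [hq, mahalanobisSq_secondMoment hx]
    exact integral_nonneg fun ω => sq_nonneg _
  have key : ∀ t : ℝ, 0 ≤ -(t * l) + 1 / 2 * (t ^ 2 * q) := by
    intro t
    have h1 := hθS (θS + t • a)
    rw [risk_add hx hy] at h1
    simp only [real_inner_smul_right] at h1
    rw [integral_const_mul, ← hl] at h1
    have h2 : mahalanobisSq (secondMoment P x) (t • a) = t ^ 2 * q := by
      rw [hq, mahalanobisSq_secondMoment hx, mahalanobisSq_secondMoment hx, ← integral_const_mul]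
      simp only [real_inner_smul_left, mul_pow]
    rw [h2] at h1
    linarith
  -- A near-optimal `t`; the denominator `q + 1` avoids a separate case `q = 0`.
  have h1 := key (l / (q + 1))
  have h2 : -(l / (q + 1) * l) + 1 / 2 * ((l / (q + 1)) ^ 2 * q) =
      -(l ^ 2 * (q + 2) / (2 * (q + 1) ^ 2)) := by
    field_simp
    ring
  rw [h2] at h1
  by_contra hne
  have : 0 < l ^ 2 * (q + 2) / (2 * (q + 1) ^ 2) := by positivity
  linarith

/-- Young's inequality with weight `A`, which balances the two fourth moments and plays the role of
Cauchy–Schwarz. -/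
theorem integral_sq_mul_sq_le {p q : Ω → ℝ} {κ A : ℝ} (hA : 0 < A)
    (hpm : AEStronglyMeasurable p P) (hqm : AEStronglyMeasurable q P)
    (hp : Integrable (fun ω => p ω ^ 4) P) (hq : Integrable (fun ω => q ω ^ 4) P)
    (hpA : ∫ ω, p ω ^ 4 ∂P ≤ κ * A ^ 2) (hqA : ∫ ω, q ω ^ 4 ∂P ≤ κ) :
    Integrable (fun ω => p ω ^ 2 * q ω ^ 2) P ∧ ∫ ω, p ω ^ 2 * q ω ^ 2 ∂P ≤ κ * A := by
  have hle : ∀ ω, p ω ^ 2 * q ω ^ 2 ≤ 1 / (2 * A) * p ω ^ 4 + A / 2 * q ω ^ 4 := by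
    intro ω
    have h1 : 1 / (2 * A) * p ω ^ 4 + A / 2 * q ω ^ 4 - p ω ^ 2 * q ω ^ 2 =
        1 / (2 * A) * (p ω ^ 2 - A * q ω ^ 2) ^ 2 := by
      field_simp
      ring
    have h2 : 0 ≤ 1 / (2 * A) * (p ω ^ 2 - A * q ω ^ 2) ^ 2 := by positivity
    linarith
  have hI : Integrable (fun ω => 1 / (2 * A) * p ω ^ 4 + A / 2 * q ω ^ 4) P :=
    (hp.const_mul _).add (hq.const_mul _)
  have hint : Integrable (fun ω => p ω ^ 2 * q ω ^ 2) P := by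
    refine hI.mono' ((hpm.pow 2).mul (hqm.pow 2)) (ae_of_all _ fun ω => ?_)
    rw [Real.norm_of_nonneg (by positivity)]
    exact hle ω
  refine ⟨hint, (integral_mono hint hI hle).trans ?_⟩
  rw [integral_add (hp.const_mul _) (hq.const_mul _), integral_const_mul, integral_const_mul]
  have h1 := mul_le_mul_of_nonneg_left hpA (show 0 ≤ 1 / (2 * A) by positivity)
  have h2 := mul_le_mul_of_nonneg_left hqA (show 0 ≤ A / 2 by positivity)
  have h3 : 1 / (2 * A) * (κ * A ^ 2) = κ * A / 2 := by field_simp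
  linarith

theorem inner_single_one (v : Vec d) (i : Fin d) :
    (inner ℝ v (EuclideanSpace.single i 1) : ℝ) = v i := by
  simp [EuclideanSpace.inner_single_right]

/-- A fourth-moment bound on projections bounds `E ‖X‖² ⟨X, a⟩²`. -/
theorem memLp_inner_smul_self {X : Ω → Vec d} {κ : ℝ} (hX : MemLp X 2 P)
    (hkurt : ∀ a, Integrable (fun ω => (inner ℝ (X ω) a : ℝ) ^ 4) P ∧
      ∫ ω, (inner ℝ (X ω) a : ℝ) ^ 4 ∂P ≤ κ * (‖a‖ ^ 2) ^ 2) (a : Vec d) :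
    MemLp (fun ω => (inner ℝ (X ω) a : ℝ) • X ω) 2 P ∧
      ∫ ω, ‖(inner ℝ (X ω) a : ℝ) • X ω‖ ^ 2 ∂P ≤ κ * d * ‖a‖ ^ 2 := by
  rcases eq_or_ne a 0 with rfl | ha
  · simp
  have hA : 0 < ‖a‖ ^ 2 := by positivity
  have hXm := hX.aestronglyMeasurable
  have hm : ∀ b : Vec d, AEStronglyMeasurable (fun ω => (inner ℝ (X ω) b : ℝ)) P :=
    fun b => (hX.inner_const b).aestronglyMeasurable
  set e : Fin d → Vec d := fun i => EuclideanSpace.single i 1 with he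
  -- Each coordinate of `X` contributes at most `κ‖a‖²`; summing over the basis gives the factor
  -- `d`.
  have hcoord := fun i => integral_sq_mul_sq_le (κ := κ) hA (hm a) (hm (e i)) (hkurt a).1
    (hkurt (e i)).1 (hkurt a).2 (by simpa [he] using (hkurt (e i)).2)
  have hexp : ∀ ω, ‖(inner ℝ (X ω) a : ℝ) • X ω‖ ^ 2 =
      ∑ i, (inner ℝ (X ω) a : ℝ) ^ 2 * (inner ℝ (X ω) (e i) : ℝ) ^ 2 := by
    intro ω
    rw [norm_smul, mul_pow, Real.norm_eq_abs, sq_abs, EuclideanSpace.real_norm_sq_eq,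
      Finset.mul_sum]
    simp only [he, inner_single_one]
  refine ⟨?_, ?_⟩
  · refine (memLp_two_iff_integrable_sq_norm ((hm a).smul hXm)).2 ?_
    change Integrable (fun ω => ‖(inner ℝ (X ω) a : ℝ) • X ω‖ ^ 2) P
    simp only [hexp]
    exact integrable_finsetSum _ fun i _ => (hcoord i).1
  · simp only [hexp]
    rw [integral_finsetSum _ fun i _ => (hcoord i).1]
    refine (Finset.sum_le_sum fun i _ => (hcoord i).2).trans ?_
    simp only [Finset.sum_const, Finset.card_univ, Fintype.card_fin, nsmul_eq_mul]
    linarith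

theorem integral_norm_sq_le {Y : Ω → Vec d} {V : ℝ} (hY : MemLp Y 2 P)
    (hV : ∀ a, ∫ ω, (inner ℝ (Y ω) a : ℝ) ^ 2 ∂P ≤ V * ‖a‖ ^ 2) :
    ∫ ω, ‖Y ω‖ ^ 2 ∂P ≤ V * d := by
  set e : Fin d → Vec d := fun i => EuclideanSpace.single i 1 with he
  have hexp : ∀ ω, ‖Y ω‖ ^ 2 = ∑ i, (inner ℝ (Y ω) (e i) : ℝ) ^ 2 := by
    intro ω
    rw [EuclideanSpace.real_norm_sq_eq]
    simp only [he, inner_single_one]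
  simp only [hexp]
  rw [integral_finsetSum _ fun i _ => (hY.inner_const (e i)).integrable_sq]
  refine (Finset.sum_le_sum fun i _ => hV (e i)).trans ?_
  simp [he, mul_comm]

/-- Integrate `2t² - 1 ≤ t⁴` at `t = ⟨X, a⟩` for a unit vector `a`. Serves to deduce `γL ≤ 1` from
the step-size condition. -/
theorem one_le_of_kurtosis [IsProbabilityMeasure P] {X : Ω → Vec d} {κ : ℝ} (hd : 0 < d) (hX : MemLp X 2 P)
    (hcov : ∀ a b, ∫ ω, (inner ℝ (X ω) a * inner ℝ (X ω) b : ℝ) ∂P = inner ℝ a b)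
    (hkurt : ∀ a, Integrable (fun ω => (inner ℝ (X ω) a : ℝ) ^ 4) P ∧
      ∫ ω, (inner ℝ (X ω) a : ℝ) ^ 4 ∂P ≤ κ * (‖a‖ ^ 2) ^ 2) : 1 ≤ κ := by
  set a : Vec d := EuclideanSpace.single ⟨0, hd⟩ 1 with ha
  have hn : ‖a‖ = 1 := by simp [ha]
  have h1 := hcov a a
  have h2 := (hkurt a).2
  have hI : Integrable (fun ω => (2 * (inner ℝ (X ω) a * inner ℝ (X ω) a) - 1 : ℝ)) P :=
    (((hX.inner_const a).integrable_mul (hX.inner_const a)).const_mul 2).sub (integrable_const _)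
  have h3 := integral_mono hI (hkurt a).1 fun ω => by
    nlinarith [sq_nonneg ((inner ℝ (X ω) a : ℝ) ^ 2 - 1)]
  rw [integral_sub (((hX.inner_const a).integrable_mul (hX.inner_const a)).const_mul 2)
    (integrable_const _), integral_const_mul] at h3
  rw [h1, real_inner_self_eq_norm_sq, hn] at h3
  rw [hn] at h2
  norm_num at h2 h3
  linarith

end LeastSquaresMoments

end DualAveraging

namespace DualAveraging

/-! ### The moment assumptions in whitened coordinates. -/

section Whitened

variable {d : ℕ} {Ω : Type*} [MeasurableSpace Ω] {P : Measure Ω} {B W : Vec d →L[ℝ] Vec d}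

/-- Polarization of `E⟨W x, B b⟩² = E⟨x, b⟩² = ‖B b‖²`, with `B` surjective. -/
theorem integral_inner_mul_inner_of_whitening {x : Ω → Vec d} (hx : MemLp x 2 P)
    (hWB : ∀ a b, inner ℝ (W a) (B b) = (inner ℝ a b : ℝ))
    (hB : ∀ v, mahalanobisSq (secondMoment P x) v = ‖B v‖ ^ 2) (a b : Vec d) :
    ∫ ω, (inner ℝ (W (x ω)) a * inner ℝ (W (x ω)) b : ℝ) ∂P = inner ℝ a b := by
  have hX : MemLp (fun ω => W (x ω)) 2 P := W.comp_memLp' hx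
  have hsq : ∀ a, ∫ ω, (inner ℝ (W (x ω)) a : ℝ) ^ 2 ∂P = ‖a‖ ^ 2 := by
    intro a
    obtain ⟨a, rfl⟩ := surjective_of_whitening hWB a
    rw [← hB, mahalanobisSq_secondMoment hx]
    simp only [hWB, real_inner_comm a]
  have hexp : ∀ ω, (inner ℝ (W (x ω)) a * inner ℝ (W (x ω)) b : ℝ) =
      4⁻¹ * ((inner ℝ (W (x ω)) (a + b)) ^ 2 - (inner ℝ (W (x ω)) (a - b)) ^ 2) := by
    intro ω
    rw [inner_add_right, inner_sub_right]
    ring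
  simp only [hexp]
  rw [integral_const_mul, integral_sub (hX.inner_const _).integrable_sq
    (hX.inner_const _).integrable_sq, hsq, hsq, norm_add_sq_real, norm_sub_sq_real]
  ring

theorem kurtosis_of_whitening {x : Ω → Vec d} {S : Matrix (Fin d) (Fin d) ℝ} {κ : ℝ}
    (hWB : ∀ a b, inner ℝ (W a) (B b) = (inner ℝ a b : ℝ))
    (hB : ∀ v, mahalanobisSq S v = ‖B v‖ ^ 2)
    (hkurt : ∀ z : Vec d, Integrable (fun ω => (inner ℝ z (x ω)) ^ 4) P ∧
        ∫ ω, (inner ℝ z (x ω)) ^ 4 ∂P ≤ κ * (mahalanobisSq S z) ^ 2) (a : Vec d) :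
    Integrable (fun ω => (inner ℝ (W (x ω)) a : ℝ) ^ 4) P ∧
      ∫ ω, (inner ℝ (W (x ω)) a : ℝ) ^ 4 ∂P ≤ κ * (‖a‖ ^ 2) ^ 2 := by
  obtain ⟨a, rfl⟩ := surjective_of_whitening hWB a
  rw [← hB]
  simpa only [hWB, real_inner_comm a] using hkurt a

theorem residual_of_whitening {ξ : Ω → Vec d} {S : Matrix (Fin d) (Fin d) ℝ} {σ : ℝ}
    (hWB : ∀ a b, inner ℝ (W a) (B b) = (inner ℝ a b : ℝ))
    (hB : ∀ v, mahalanobisSq S v = ‖B v‖ ^ 2) (hξ2 : MemLp ξ 2 P)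
    (hξ : (σ ^ 2 • S - secondMoment P ξ).PosSemidef) :
    MemLp (fun ω => W (ξ ω)) 2 P ∧ ∫ ω, ‖W (ξ ω)‖ ^ 2 ∂P ≤ σ ^ 2 * d := by
  have hmem : MemLp (fun ω => W (ξ ω)) 2 P := W.comp_memLp' hξ2
  refine ⟨hmem, integral_norm_sq_le hmem fun a => ?_⟩
  obtain ⟨a, rfl⟩ := surjective_of_whitening hWB a
  have h1 := hξ.dotProduct_mulVec_nonneg a.ofLp
  rw [star_trivial, Matrix.sub_mulVec, Matrix.smul_mulVec, dotProduct_sub, dotProduct_smul,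
    smul_eq_mul] at h1
  change 0 ≤ σ ^ 2 * mahalanobisSq S a - mahalanobisSq (secondMoment P ξ) a at h1
  rw [hB, mahalanobisSq_secondMoment hξ2] at h1
  simp only [hWB, real_inner_comm a]
  linarith

end Whitened

/-! ### Lipschitz dependence of the primal step on the dual point. -/

section Primal

variable {d : ℕ} {h g : Vec d → EReal} {γ L : ℝ} {B W : Vec d →L[ℝ] Vec d}
  {D : Set (Vec d)} {φ : Vec d → ℝ}

/-- Strong monotonicity and Cauchy–Schwarz, cancelling one factor `‖B (u - u')‖`. It yields
uniqueness of the primal step and its continuity, hence measurability of the iterates. -/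
theorem IsStrongMin.norm_sub_le (hWB : ∀ a b, inner ℝ (W a) (B b) = (inner ℝ a b : ℝ))
    (hL : 0 < L) {e e' u u' : Vec d}
    (hu : IsStrongMin B L D (fun p => φ p - inner ℝ e p) u)
    (hu' : IsStrongMin B L D (fun p => φ p - inner ℝ e' p) u') :
    ‖u - u'‖ ≤ ‖W‖ * (L * ‖W‖) * ‖e - e'‖ := by
  have h1 := hu.monotone_tilt hL hu'
  have h2 : (inner ℝ (e - e') (u - u') : ℝ) ≤ ‖W‖ * ‖e - e'‖ * ‖B (u - u')‖ := by
    rw [← hWB]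
    refine (real_inner_le_norm _ _).trans ?_
    gcongr
    exact W.le_opNorm _
  have h3 : ‖B (u - u')‖ ≤ L * ‖W‖ * ‖e - e'‖ := by
    rcases (norm_nonneg (B (u - u'))).eq_or_lt with h0 | h0
    · rw [← h0]
      positivity
    · refine le_of_mul_le_mul_right ?_ h0
      have := mul_le_mul_of_nonneg_left h2 hL.le
      nlinarith
  have h4 := norm_le_of_whitening hWB (u - u')
  have h5 := mul_le_mul_of_nonneg_left h3 (norm_nonneg W)
  linarith

theorem IsStrongMin.unique (hWB : ∀ a b, inner ℝ (W a) (B b) = (inner ℝ a b : ℝ))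
    (hL : 0 < L) {e u u' : Vec d}
    (hu : IsStrongMin B L D (fun p => φ p - inner ℝ e p) u)
    (hu' : IsStrongMin B L D (fun p => φ p - inner ℝ e p) u') : u = u' := by
  have := hu.norm_sub_le hWB hL hu'
  rw [sub_self, norm_zero, mul_zero] at this
  exact sub_eq_zero.1 (norm_le_zero_iff.1 this)

theorem continuous_of_isStrongMin (hWB : ∀ a b, inner ℝ (W a) (B b) = (inner ℝ a b : ℝ))
    (hL : 0 < L) {T : Vec d → Vec d}
    (hT : ∀ e, IsStrongMin B L D (fun p => φ p - inner ℝ e p) (T e)) : Continuous T := by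
  refine (LipschitzWith.of_dist_le_mul (K := ⟨‖W‖ * (L * ‖W‖), by positivity⟩)
    fun e e' => ?_).continuous
  rw [dist_eq_norm, dist_eq_norm]
  exact (hT e).norm_sub_le hWB hL (hT e')

theorem norm_sq_average_le (w : ℕ → Vec d) {n : ℕ} (hn : 1 ≤ n) :
    ‖(1 / (n : ℝ)) • ∑ k ∈ Finset.range n, w k‖ ^ 2 ≤
      1 / n * ∑ k ∈ Finset.range n, ‖w k‖ ^ 2 := by
  have hn' : (0 : ℝ) < n := by exact_mod_cast hn
  have h1 : ‖∑ k ∈ Finset.range n, w k‖ ^ 2 ≤ n * ∑ k ∈ Finset.range n, ‖w k‖ ^ 2 := by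
    refine (pow_le_pow_left₀ (norm_nonneg _) (norm_sum_le _ _) 2).trans ?_
    simpa using sq_sum_le_card_mul_sum_sq (s := Finset.range n) (f := fun k => ‖w k‖)
  rw [norm_smul, mul_pow, Real.norm_of_nonneg (by positivity)]
  calc (1 / (n : ℝ)) ^ 2 * ‖∑ k ∈ Finset.range n, w k‖ ^ 2
      ≤ (1 / (n : ℝ)) ^ 2 * (n * ∑ k ∈ Finset.range n, ‖w k‖ ^ 2) := by gcongr
    _ = _ := by field_simp

end Primal

/-! ### Coupling of stochastic and noiseless iterates. -/

section Coupling

variable {d : ℕ} {Ω : Type*} [MeasurableSpace Ω] {P : Measure Ω} [IsProbabilityMeasure P]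
  {h g : Vec d → EReal} {γ L : ℝ} {B W : Vec d →L[ℝ] Vec d}

/-- The gap between stochastic and noiseless dual averaging started from the same dual point. -/
theorem lintegral_coupling_le (hWB : ∀ a b, inner ℝ (W a) (B b) = (inner ℝ a b : ℝ))
    (hγ : 0 < γ) (hL : 0 < L) {K V : ℝ} (hK0 : 0 ≤ K) (hV0 : 0 ≤ V)
    (hγK : 2 * γ * K * L ≤ 1) {x : ℕ → Ω → Vec d}
    {y : ℕ → Ω → ℝ} (hx_meas : ∀ n, Measurable (x n)) (hy_meas : ∀ n, Measurable (y n))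
    (hindep : iIndepFun (fun n ω => (x n ω, y n ω)) P)
    (hident : ∀ n, IdentDistrib (fun ω => (x n ω, y n ω)) (fun ω => (x 0 ω, y 0 ω)) P P)
    {θS : Vec d} (hX : MemLp (fun ω => W (x 0 ω)) 2 P)
    (hcov : ∀ a b, ∫ ω, (inner ℝ (W (x 0 ω)) a * inner ℝ (W (x 0 ω)) b : ℝ) ∂P = inner ℝ a b)
    (hK : ∀ a, MemLp (fun ω => (inner ℝ (W (x 0 ω)) a : ℝ) • W (x 0 ω)) 2 P ∧
      ∫ ω, ‖(inner ℝ (W (x 0 ω)) a : ℝ) • W (x 0 ω)‖ ^ 2 ∂P ≤ K * ‖a‖ ^ 2)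
    (hε : MemLp (fun ω => (y 0 ω - inner ℝ θS (x 0 ω)) • W (x 0 ω)) 2 P)
    (hεV : ∫ ω, ‖(y 0 ω - inner ℝ θS (x 0 ω)) • W (x 0 ω)‖ ^ 2 ∂P ≤ V)
    (hε0 : ∀ a, ∫ ω, (inner ℝ ((y 0 ω - inner ℝ θS (x 0 ω)) • W (x 0 ω)) a : ℝ) ∂P = 0)
    {T : ℕ → Vec d → Vec d}
    (hT : ∀ n e, IsStrongMin B L (feasible h g n)
      (fun p => regularizedReal h g γ n p - inner ℝ e p) (T n e))
    {e : ℕ → Vec d}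
    (he : ∀ k, e (k + 1) = e k - γ • ContinuousLinearMap.adjoint B (B (T k (e k) - θS)))
    {η : ℕ → Ω → Vec d} (hη0 : ∀ ω, η 0 ω = e 0)
    (hη : ∀ n ω, η (n + 1) ω =
      η n ω - (γ * (inner ℝ (x n ω) (T n (η n ω)) - y n ω)) • x n ω) (n : ℕ) :
    ∫⁻ ω, ENNReal.ofReal (‖W (η n ω - e n)‖ ^ 2 + ‖W (η n ω - e n) +
        γ • ∑ k ∈ Finset.range n, B (T k (η k ω) - T k (e k))‖ ^ 2) ∂P ≤
      ENNReal.ofReal (∑ k ∈ Finset.range n,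
        8 * γ ^ 2 * (K * ‖B (T k (e k) - θS)‖ ^ 2 + V)) := by
  have hTc : ∀ n, Continuous (T n) := fun n => continuous_of_isStrongMin hWB hL (hT n)
  -- The state carries the accumulated primal gap along with the dual iterate, so that the potential
  -- is a function of the current state alone.
  set F : ℕ → Vec d × Vec d → Vec d × ℝ → Vec d × Vec d := fun n s z =>
    (s.1 - (γ * (inner ℝ z.1 (T n s.1) - z.2)) • z.1, s.2 + B (T n s.1 - T n (e n))) with hF
  set Φ : ℕ → Vec d × Vec d → ℝ := fun n s =>
    ‖W (s.1 - e n)‖ ^ 2 + ‖W (s.1 - e n) + γ • s.2‖ ^ 2 with hΦ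
  have hmain := lintegral_potential_le (P := P) (F := F) (Φ := Φ)
    (z := fun n ω => (x n ω, y n ω))
    (s := fun n ω => (η n ω, ∑ k ∈ Finset.range n, B (T k (η k ω) - T k (e k))))
    (s₀ := (e 0, 0)) (c := fun k => 8 * γ ^ 2 * (K * ‖B (T k (e k) - θS)‖ ^ 2 + V))
    (fun n => Continuous.measurable (by
      have := hTc n
      fun_prop))
    (fun ω => by simp [hη0])
    (fun n ω => by simp only [hF, hη, Finset.sum_range_succ])
    (fun n => (hx_meas n).prodMk (hy_meas n)) hindep hident
    (fun n => Continuous.measurable (by fun_prop))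
    (fun n s => by positivity) (fun k => by positivity) ?_ n
  · simpa [hΦ] using hmain
  intro n s
  set δ := B (T n s.1 - T n (e n)) with hδ
  set c := B (T n (e n) - θS) with hc
  obtain ⟨hv1, hv2, hv3⟩ := whitened_gradient_moments hX hcov hK hε hεV hε0 δ c rfl
  have hmono : ‖δ‖ ^ 2 ≤ L * inner ℝ (W (s.1 - e n)) δ := by
    rw [hδ, hWB]
    exact (hT n s.1).monotone_tilt hL (hT n (e n))
  refine le_trans (le_of_eq ?_) (lintegral_potential_step_le hγ hL hγK s.2 hv1 hv2 hv3 hmono)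
  refine lintegral_congr fun ω => ?_
  have hW : W (s.1 - (γ * (inner ℝ (x 0 ω) (T n s.1) - y 0 ω)) • x 0 ω - e (n + 1)) =
      W (s.1 - e n) - γ • ((inner ℝ (W (x 0 ω)) δ : ℝ) • W (x 0 ω) +
        (inner ℝ (W (x 0 ω)) c : ℝ) • W (x 0 ω) - c -
        (y 0 ω - inner ℝ θS (x 0 ω)) • W (x 0 ω)) := by
    rw [he n, ← hc]
    simp only [map_sub, map_smul, whitening_adjoint hWB]
    have h1 : (inner ℝ (x 0 ω) (T n s.1) : ℝ) = inner ℝ (W (x 0 ω)) δ +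
        inner ℝ (W (x 0 ω)) c + inner ℝ θS (x 0 ω) := by
      rw [hδ, hc, hWB, hWB, real_inner_comm (x 0 ω) θS, ← inner_add_right, ← inner_add_right]
      congr 1
      abel
    rw [h1]
    module
  simp only [hΦ, hF, hW, ← hδ]

/-- The convergence rate of averaged dual averaging, in whitened coordinates. -/
theorem lintegral_norm_sq_averaged_le
    (hγ : 0 < γ) {θS θstar : Vec d} {T : ℕ → Vec d → Vec d} {e : ℕ → Vec d}
    {η θ : ℕ → Ω → Vec d} (hθ : ∀ n ω, θ n ω = T n (η n ω)) {K V D : ℝ} (hK0 : 0 ≤ K)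
    (hV0 : 0 ≤ V) {n : ℕ} (hn : 1 ≤ n)
    (hcouple : ∫⁻ ω, ENNReal.ofReal (‖W (η n ω - e n)‖ ^ 2 + ‖W (η n ω - e n) +
        γ • ∑ k ∈ Finset.range n, B (T k (η k ω) - T k (e k))‖ ^ 2) ∂P ≤
      ENNReal.ofReal (∑ k ∈ Finset.range n,
        8 * γ ^ 2 * (K * ‖B (T k (e k) - θS)‖ ^ 2 + V)))
    (hdet : γ * ∑ k ∈ Finset.range n, 1 / 2 * ‖B (T k (e k) - θstar)‖ ^ 2 ≤ D) :
    2⁻¹ * ∫⁻ ω, ENNReal.ofReal (‖B (averaged θ n ω - θstar)‖ ^ 2) ∂P ≤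
      ENNReal.ofReal (2 / (γ * n) * D + 16 / n * (V + 2 * K * ‖B (θstar - θS)‖ ^ 2) +
        64 * K / n ^ 2 * (D / γ)) := by
  have hn' : (0 : ℝ) < n := by exact_mod_cast hn
  have par : ∀ p q : Vec d, ‖p + q‖ ^ 2 ≤ 2 * ‖p‖ ^ 2 + 2 * ‖q‖ ^ 2 := by
    intro p q
    have := parallelogram_law_with_norm ℝ p q
    nlinarith [sq_nonneg ‖p - q‖]
  set Q := ∑ k ∈ Finset.range n, ‖B (T k (e k) - θstar)‖ ^ 2 with hQ
  set M := ‖B (θstar - θS)‖ ^ 2 with hM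
  have hQ0 : 0 ≤ Q := Finset.sum_nonneg fun k _ => sq_nonneg _
  have hQD : γ * Q ≤ 2 * D := by
    rw [← Finset.mul_sum] at hdet
    linarith
  set Ψ : Ω → ℝ := fun ω => ‖W (η n ω - e n)‖ ^ 2 + ‖W (η n ω - e n) +
        γ • ∑ k ∈ Finset.range n, B (T k (η k ω) - T k (e k))‖ ^ 2 with hΨ
  -- The average error is the noiseless average error plus `R / n`; the former is bounded by
  -- convexity of the square, the latter by the potential through `γR = (w + γR) - w`.
  have hpt : ∀ ω, ‖B (averaged θ n ω - θstar)‖ ^ 2 ≤ 2 / n * Q + 4 / (γ * n) ^ 2 * Ψ ω := by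
    intro ω
    set R := ∑ k ∈ Finset.range n, B (T k (η k ω) - T k (e k)) with hR
    have hsplit : B (averaged θ n ω - θstar) =
        (1 / (n : ℝ)) • ∑ k ∈ Finset.range n, B (T k (e k) - θstar) + (1 / (n : ℝ)) • R := by
      have h1 : ∀ k ∈ Finset.range n,
          B (T k (e k) - θstar) + B (T k (η k ω) - T k (e k)) = B (θ k ω) - B θstar := by
        intro k _
        rw [hθ]
        simp only [map_sub]
        abel
      rw [← smul_add, hR, ← Finset.sum_add_distrib, averaged, Finset.sum_congr rfl h1,
        Finset.sum_sub_distrib, Finset.sum_const, Finset.card_range, map_sub, map_smul, map_sum,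
        smul_sub, ← Nat.cast_smul_eq_nsmul ℝ, smul_smul, one_div_mul_cancel hn'.ne', one_smul]
    have h1 := par ((1 / (n : ℝ)) • ∑ k ∈ Finset.range n, B (T k (e k) - θstar))
      ((1 / (n : ℝ)) • R)
    rw [← hsplit] at h1
    have h2 := norm_sq_average_le (fun k => B (T k (e k) - θstar)) hn
    have h3 := par (-W (η n ω - e n)) (W (η n ω - e n) + γ • R)
    rw [neg_add_cancel_left, norm_neg, norm_smul, mul_pow, Real.norm_of_nonneg hγ.le] at h3
    have h4 : ‖(1 / (n : ℝ)) • R‖ ^ 2 ≤ 2 / (γ * n) ^ 2 * Ψ ω := by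
      rw [norm_smul, mul_pow, Real.norm_of_nonneg (by positivity), div_mul_eq_mul_div,
        le_div_iff₀ (by positivity)]
      have h5 : (1 / (n : ℝ)) ^ 2 * ‖R‖ ^ 2 * (γ * n) ^ 2 = γ ^ 2 * ‖R‖ ^ 2 := by field_simp
      rw [h5]
      linarith
    have h6 : 2 / (n : ℝ) * Q = 2 * (1 / n * Q) := by ring
    have h7 : 4 / (γ * n) ^ 2 * Ψ ω = 2 * (2 / (γ * n) ^ 2 * Ψ ω) := by ring
    rw [h6, h7]
    linarith
  -- The noise level is measured from `θS`, while the noiseless bound controls distances to `θstar`.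
  have hc : ∀ k, K * ‖B (T k (e k) - θS)‖ ^ 2 + V ≤
      2 * K * ‖B (T k (e k) - θstar)‖ ^ 2 + (2 * K * M + V) := by
    intro k
    have h1 := par (B (T k (e k) - θstar)) (B (θstar - θS))
    rw [← map_add, sub_add_sub_cancel] at h1
    have := mul_le_mul_of_nonneg_left h1 hK0
    linarith
  have hsum : ∑ k ∈ Finset.range n, 8 * γ ^ 2 * (K * ‖B (T k (e k) - θS)‖ ^ 2 + V) ≤
      8 * γ ^ 2 * (2 * K * Q + n * (2 * K * M + V)) := by
    rw [← Finset.mul_sum]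
    refine mul_le_mul_of_nonneg_left ((Finset.sum_le_sum fun k _ => hc k).trans ?_)
      (by positivity)
    rw [Finset.sum_add_distrib, ← Finset.mul_sum, ← hQ, Finset.sum_const, Finset.card_range,
      nsmul_eq_mul]
  have hΨ0 : ∀ ω, 0 ≤ Ψ ω := fun ω => by positivity
  have hM0 : 0 ≤ M := sq_nonneg _
  have hcouple' : ∫⁻ ω, ENNReal.ofReal (Ψ ω) ∂P ≤
      ENNReal.ofReal (8 * γ ^ 2 * (2 * K * Q + n * (2 * K * M + V))) :=
    hcouple.trans (ENNReal.ofReal_le_ofReal hsum)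
  clear_value Ψ Q M
  calc 2⁻¹ * ∫⁻ ω, ENNReal.ofReal (‖B (averaged θ n ω - θstar)‖ ^ 2) ∂P
      ≤ 2⁻¹ * ∫⁻ ω, (ENNReal.ofReal (2 / n * Q) +
          ENNReal.ofReal (4 / (γ * n) ^ 2) * ENNReal.ofReal (Ψ ω)) ∂P := by
        refine mul_le_mul_right (lintegral_mono fun ω => ?_) _
        rw [← ENNReal.ofReal_mul (by positivity),
          ← ENNReal.ofReal_add (by positivity) (mul_nonneg (by positivity) (hΨ0 ω))]
        exact ENNReal.ofReal_le_ofReal (hpt ω)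
    _ ≤ 2⁻¹ * (ENNReal.ofReal (2 / n * Q) + ENNReal.ofReal (4 / (γ * n) ^ 2) *
          ENNReal.ofReal (8 * γ ^ 2 * (2 * K * Q + n * (2 * K * M + V)))) := by
        rw [lintegral_add_left measurable_const, lintegral_const, measure_univ, mul_one,
          lintegral_const_mul' _ _ ENNReal.ofReal_ne_top]
        gcongr
    _ = ENNReal.ofReal (2⁻¹ * (2 / n * Q + 4 / (γ * n) ^ 2 *
          (8 * γ ^ 2 * (2 * K * Q + n * (2 * K * M + V))))) := by
        rw [← ENNReal.ofReal_mul (by positivity),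
          ← ENNReal.ofReal_add (by positivity) (by positivity),
          ENNReal.ofReal_mul (p := 2⁻¹) (by norm_num), ENNReal.ofReal_inv_of_pos (by norm_num)]
        norm_num
    _ ≤ _ := by
        refine ENNReal.ofReal_le_ofReal ?_
        have h1 : 2⁻¹ * (2 / n * Q + 4 / (γ * n) ^ 2 *
          (8 * γ ^ 2 * (2 * K * Q + n * (2 * K * M + V)))) =
          1 / (γ * n) * (γ * Q) + 32 * K / (γ * n ^ 2) * (γ * Q) +
            16 / n * (V + 2 * K * M) := by
          field_simp
          ring
        have h2 : 1 / (γ * n) * (γ * Q) ≤ 1 / (γ * n) * (2 * D) := by gcongr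
        have h3 : 32 * K / (γ * n ^ 2) * (γ * Q) ≤ 32 * K / (γ * n ^ 2) * (2 * D) := by gcongr
        have h4 : 1 / (γ * n) * (2 * D) = 2 / (γ * n) * D := by ring
        have h5 : 32 * K / (γ * n ^ 2) * (2 * D) = 64 * K / n ^ 2 * (D / γ) := by
          field_simp
          ring
        rw [h1]
        linarith

end Coupling

end DualAveraging

/-! ### Assembly of the rate. -/

theorem proposition3 {d : ℕ} (hd : 0 < d)
    {Ω : Type*} [MeasurableSpace Ω] (P : Measure Ω) [IsProbabilityMeasure P]
    -- the regularizer, the geometry and the constraint set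
    (g h : Vec d → EReal) (X : Set (Vec d))
    (hg_proper : IsProper g) (hg_lsc : LowerSemicontinuous g)
    (hg_convex : IsConvex g)
    (hX : closure (dom h) ∩ closure (dom g) = X)
    (hdom : (interior (dom h) ∩ dom g).Nonempty)
    (hh : IsLegendre h)
    -- i.i.d. observations with finite variances
    (x : ℕ → Ω → Vec d) (y : ℕ → Ω → ℝ)
    (hx_meas : ∀ n, Measurable (x n)) (hy_meas : ∀ n, Measurable (y n))
    (hindep : iIndepFun (fun n ω => (x n ω, y n ω)) P)
    (hident : ∀ n, IdentDistrib (fun ω => (x n ω, y n ω)) (fun ω => (x 0 ω, y 0 ω)) P P)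
    (hx_sq : MemLp (x 0) 2 P) (hy_sq : MemLp (y 0) 2 P)
    -- a minimizer of the composite objective over the constraint set
    (θstar : Vec d) (hθstar_mem : θstar ∈ X)
    (hθstar : ∀ θ ∈ X,
      ((risk P (x 0) (y 0) θstar : ℝ) : EReal) + g θstar ≤
        ((risk P (x 0) (y 0) θ : ℝ) : EReal) + g θ)
    -- the covariance matrix, invertible, and the global minimizer of the risk
    (S : Matrix (Fin d) (Fin d) ℝ) (hS : S = secondMoment P (x 0))
    (hS_inv : IsUnit S)
    (θS : Vec d)
    (hθS : ∀ θ, risk P (x 0) (y 0) θS ≤ risk P (x 0) (y 0) θ)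
    -- the residual has a covariance bounded by `σ² S`
    (σ : ℝ) (hσ : 0 < σ)
    (hξ_sq : MemLp (fun ω => (y 0 ω - inner ℝ θS (x 0 ω)) • x 0 ω) 2 P)
    (hξ : (σ ^ 2 • S - secondMoment P
      (fun ω => (y 0 ω - inner ℝ θS (x 0 ω)) • x 0 ω)).PosSemidef)
    -- bounded kurtosis of the projections of the covariates
    (κ : ℝ) (hκ : 0 < κ)
    (hkurt : ∀ z : Vec d,
      Integrable (fun ω => (inner ℝ z (x 0 ω)) ^ 4) P ∧
        ∫ ω, (inner ℝ z (x 0 ω)) ^ 4 ∂P ≤ κ * (mahalanobisSq S z) ^ 2)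
    -- the regularizer is nonnegative
    (hg_nonneg : ∀ θ, 0 ≤ g θ)
    -- compatibility of the geometry with the quadratic objective
    (L : ℝ) (hL : 0 < L)
    (hLh : IsConvex fun θ =>
      (L : EReal) * h θ - (((1 / 2) * mahalanobisSq S θ : ℝ) : EReal))
    -- the algorithm
    (γ : ℝ) (hγ : 0 < γ) (hγ_le : γ ≤ 1 / (4 * κ * L * d))
    (θ₀ : Vec d) (hθ₀ : θ₀ ∈ interior (dom h))
    (η θ : ℕ → Ω → Vec d)
    (hSDA : IsSDA h g γ x y θ₀ η θ)
    (n : ℕ) (hn : 1 ≤ n) :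
    ((2⁻¹ * ∫⁻ ω, ENNReal.ofReal
        (mahalanobisSq S (averaged θ n ω - θstar)) ∂P : ℝ≥0∞) : EReal) ≤
      ((2 / (γ * n) : ℝ) : EReal) * bregman h θstar θ₀
      + ((32 * d / n * (σ ^ 2 + κ * mahalanobisSq S (θstar - θS)) : ℝ) : EReal)
      + ((16 * κ * d / n ^ 2 : ℝ) : EReal) *
          (((5 / γ : ℝ) : EReal) * bregman h θstar θ₀ + g θ₀) := by
  have hbot := hh.proper.1
  have hgbot := ne_bot_of_nonneg hg_nonneg
  have hn' : (0 : ℝ) < n := by exact_mod_cast hn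
  have hd' : (0 : ℝ) < d := by exact_mod_cast hd
  obtain ⟨B, W, hBS, hWB⟩ := exists_whitening (hS ▸ posSemidef_secondMoment hx_sq) hS_inv
  have hB : ∀ v, mahalanobisSq (secondMoment P (x 0)) v = ‖B v‖ ^ 2 := hS ▸ hBS
  -- the whitened data
  have hWx : MemLp (fun ω => W (x 0 ω)) 2 P := W.comp_memLp' hx_sq
  have hcov := integral_inner_mul_inner_of_whitening hx_sq hWB hB
  have hkurtX := kurtosis_of_whitening hWB hBS hkurt
  have hK := memLp_inner_smul_self hWx hkurtX
  have hκ1 := one_le_of_kurtosis hd hWx hcov hkurtX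
  obtain ⟨hε, hεV⟩ := residual_of_whitening hWB hBS hξ_sq hξ
  simp only [map_smul] at hε hεV
  have hε0 : ∀ a, ∫ ω, (inner ℝ ((y 0 ω - inner ℝ θS (x 0 ω)) • W (x 0 ω)) a : ℝ) ∂P = 0 := by
    intro a
    obtain ⟨a, rfl⟩ := surjective_of_whitening hWB a
    simp only [← map_smul, hWB]
    exact integral_residual_eq_zero hx_sq hy_sq hθS a
  have hrisk : ∀ p, risk P (x 0) (y 0) p =
      risk P (x 0) (y 0) θS + 1 / 2 * ‖B (p - θS)‖ ^ 2 := by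
    intro p
    have h1 := risk_add hx_sq hy_sq θS (p - θS)
    rwa [add_sub_cancel, integral_residual_eq_zero hx_sq hy_sq hθS, sub_zero, hB] at h1
  -- the step size
  have hγK : γ * (κ * d) * L ≤ 1 / 4 := by
    rw [le_div_iff₀ (by positivity)] at hγ_le
    linarith
  have hκd : 1 ≤ κ * d := by
    have : (1 : ℝ) ≤ d := by exact_mod_cast hd
    nlinarith
  have hγL : γ * L ≤ 1 := by
    have h1 : γ * L ≤ γ * L * (κ * d) := le_mul_of_one_le_right (by positivity) hκd
    linarith
  -- the optimum
  obtain ⟨q, hqh, hqg⟩ := hdom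
  have hfeas : ∀ k, (feasible h g k).Nonempty := fun k => ⟨q, interior_subset hqh, fun _ => hqg⟩
  have hsubX : feasible h g 1 ⊆ X := fun p hp => by
    rw [← hX]
    exact ⟨subset_closure hp.1, subset_closure (hp.2 one_ne_zero)⟩
  have hgstar : g θstar ≠ ⊤ := by
    intro htop
    have h1 := hθstar q (hsubX ⟨interior_subset hqh, fun _ => hqg⟩)
    rw [htop, EReal.coe_add_top, top_le_iff] at h1
    exact EReal.add_ne_top (EReal.coe_ne_top _) hqg h1
  have hopt : ∀ p ∈ feasible h g 1, (g θstar).toReal + 1 / 2 * ‖B (θstar - θS)‖ ^ 2 ≤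
      (g p).toReal + 1 / 2 * ‖B (p - θS)‖ ^ 2 := by
    intro p hp
    have h1 := hθstar p (hsubX hp)
    rw [← EReal.coe_toReal hgstar (hgbot _),
      ← EReal.coe_toReal (hp.2 one_ne_zero) (hgbot p), ← EReal.coe_add, ← EReal.coe_add,
      EReal.coe_le_coe_iff, hrisk θstar, hrisk p] at h1
    linarith
  -- the mirror map
  have hsc : StronglyConvexFor B L (dom h) fun p => (h p).toReal :=
    stronglyConvexFor_toReal hbot hL (by simpa only [hBS] using hLh)
  have hθ₀h : θ₀ ∈ dom h := interior_subset hθ₀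
  have hmin₀ := hsc.isStrongMin_of_hasGradientAt hL hθ₀h (hh.differentiable θ₀ hθ₀).2
  choose T hT using fun n e => exists_isStrongMin hWB hbot hg_nonneg hg_convex
    hh.lowerSemicontinuous hg_lsc hγ hL hsc hmin₀ n (hfeas n) e
  -- At level `0` the objective is `h - ⟨∇h(θ₀), ·⟩`, minimized at `θ₀`; hence both runs start at
  -- the same primal point.
  have hT0 : T 0 (egradient h θ₀) = θ₀ := by
    refine (hT 0 _).unique hWB hL ⟨⟨hθ₀h, fun h0 => absurd rfl h0⟩, fun p hp => ?_⟩
    simpa [regularizedReal] using hmin₀.2 p hp.1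
  have hθ : ∀ n ω, θ n ω = T n (η n ω) := by
    intro k ω
    cases k with
    | zero => rw [hSDA.primal_zero, hSDA.dual_zero, hT0]
    | succ k =>
      exact eq_of_hasEGradientAt_conjugate hbot hg_nonneg hγ hL (hT _ _) (hSDA.primal_succ k ω)
  set e : ℕ → Vec d := fun k => Nat.rec (egradient h θ₀)
    (fun k v => v - γ • ContinuousLinearMap.adjoint B (B (T k v - θS))) k with he
  have he0 : e 0 = egradient h θ₀ := rfl
  have he_succ : ∀ k, e (k + 1) =
    e k - γ • ContinuousLinearMap.adjoint B (B (T k (e k) - θS)) := fun k => rfl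
  clear_value e
  -- Here `K = κd` and `V = σ²d`; the step-size condition gives `2γKL ≤ 1/2`.
  have hcouple := lintegral_coupling_le hWB hγ hL (K := κ * d) (by positivity)
    (by positivity : (0 : ℝ) ≤ σ ^ 2 * d) (by linarith) hx_meas hy_meas hindep hident hWx hcov hK
    hε hεV hε0 hT he_succ (η := η) (fun ω => by rw [hSDA.dual_zero, he0])
    (fun k ω => by rw [hSDA.dual_succ, hθ]) n
  -- the case of an infinite right-hand side
  have hθ₀bot : h θ₀ ≠ ⊥ := hbot θ₀
  have hc1 : 0 < 2 / (γ * n) := by positivity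
  have hc2 : 0 < 16 * κ * d / (n : ℝ) ^ 2 := by positivity
  have hc3 : 0 < 5 / γ := by positivity
  by_cases hstar : h θstar = ⊤
  · have hD : bregman h θstar θ₀ = ⊤ := by
      rw [bregman, hstar, ← EReal.coe_toReal hθ₀h hθ₀bot, EReal.top_sub_coe, EReal.top_sub_coe]
    rw [hD, EReal.coe_mul_top_of_pos hc1, EReal.coe_mul_top_of_pos hc3,
      EReal.top_add_of_ne_bot (hgbot _), EReal.coe_mul_top_of_pos hc2, EReal.top_add_coe,
      EReal.top_add_top]
    exact le_top
  set D : ℝ := (h θstar).toReal - (h θ₀).toReal - inner ℝ (egradient h θ₀) (θstar - θ₀) with hDdef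
  have hD : bregman h θstar θ₀ = ((D : ℝ) : EReal) := by
    rw [bregman, hDdef, EReal.coe_sub, EReal.coe_sub, EReal.coe_toReal hstar (hbot _),
      EReal.coe_toReal hθ₀h hθ₀bot]
  have hdet := sum_norm_sq_noiseless_le hγ hL hγL hstar hgstar (fun k => hT k (e k)) he_succ hopt n
  rw [he0, hT0] at hdet
  have hdet' : γ * ∑ k ∈ Finset.range n, 1 / 2 * ‖B (T k (e k) - θstar)‖ ^ 2 ≤ D := by
    refine hdet.trans (le_of_eq ?_)
    rw [hDdef, inner_sub_right]
    ring
  have hD0 : 0 ≤ D := le_trans (by positivity) hdet'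
  have hfinal := lintegral_norm_sq_averaged_le hγ hθ (by positivity) (by positivity) hn hcouple
    hdet'
  simp only [hBS]
  rw [hD]
  by_cases hg0 : g θ₀ = ⊤
  · rw [hg0, ← EReal.coe_mul (5 / γ) D, EReal.coe_add_top, EReal.coe_mul_top_of_pos hc2,
      ← EReal.coe_mul, ← EReal.coe_add, EReal.coe_add_top]
    exact le_top
  have hg0' : 0 ≤ (g θ₀).toReal := EReal.toReal_nonneg (hg_nonneg θ₀)
  rw [← EReal.coe_toReal hg0 (hgbot _)]
  refine (EReal.coe_ennreal_le_coe_ennreal_iff.2 hfinal).trans ?_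
  rw [EReal.coe_ennreal_ofReal, max_eq_left (by positivity)]
  rw [← EReal.coe_mul (2 / (γ * n)) D, ← EReal.coe_mul (5 / γ) D,
    ← EReal.coe_add (5 / γ * D), ← EReal.coe_mul, ← EReal.coe_add, ← EReal.coe_add, EReal.coe_le_coe_iff]
  -- The bound obtained is slightly sharper than the claim: `16` instead of `32` on `σ²`, `64`
  -- instead of `80` on `D/γ`, and no term in `g θ₀`.
  have h1 : 16 / (n : ℝ) * (σ ^ 2 * d + 2 * (κ * d) * ‖B (θstar - θS)‖ ^ 2) ≤
      32 * d / n * (σ ^ 2 + κ * ‖B (θstar - θS)‖ ^ 2) := by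
    have h2 : 32 * d / n * (σ ^ 2 + κ * ‖B (θstar - θS)‖ ^ 2) -
        16 / (n : ℝ) * (σ ^ 2 * d + 2 * (κ * d) * ‖B (θstar - θS)‖ ^ 2) = 16 * d / n * σ ^ 2 := by
      ring
    have h3 : 0 ≤ 16 * d / (n : ℝ) * σ ^ 2 := by positivity
    linarith
  have h4 : 64 * (κ * d) / (n : ℝ) ^ 2 * (D / γ) ≤
      16 * κ * d / n ^ 2 * (5 / γ * D + (g θ₀).toReal) := by
    have h5 : 16 * κ * d / n ^ 2 * (5 / γ * D + (g θ₀).toReal) -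
        64 * (κ * d) / (n : ℝ) ^ 2 * (D / γ) =
        16 * κ * d / n ^ 2 * (D / γ + (g θ₀).toReal) := by ring
    have h6 : 0 ≤ 16 * κ * d / (n : ℝ) ^ 2 * (D / γ + (g θ₀).toReal) := by positivity
    linarith
  linarith
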